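/- **Setting.** Let $n\ge 1$, $A\in\mathbb R^{n\times n}$, $\beta:[t_0,T]\to\mathbb R^n$ sufficiently smooth, and consider $\dot x=Ax+\beta(t)$, written autonomously for $z=(x,t)$ as $\dot z=f^{[1]}(z)+f^{[2]}(z)$ with the port-based ("frozen time") decomposition $f^{[1]}(x,t)=(\beta(t),0)$, $f^{[2]}(x,t)=(Ax,1)$. Its subflows are $\varphi^{[1]}_\tau(x,t)=(x+\tau\beta(t),t)$ and $\varphi^{[2]}_\tau(x,t)=(e^{\tau A}x,t+\tau)$. For step sizes $a,b\in\mathbb R^m$ ($m$ is called the number of degrees of freedom) let $$\Phi_h=\varphi^{[2]}_{b_mh}\circ\varphi^{[1]}_{a_mh}\circ\cdots\circ\varphi^{[2]}_{b_1h}\circ\varphi^{[1]}_{a_1h}.$$ The scheme is *symmetric* if it belongs to * class a): $a_i=a_{m+1-i}$ for $1\le i\le m$, $b_m=0$, $b_i=b_{m-i}$ for $1\le i\le m-1$; or * class b): $a_1=0$, $a_i=a_{m+2-i}$ for $2\le i\le m$, $b_i=b_{m+1-i}$ for $1\le i\le m$, so that it has $2m-1$ stages. It *has order $p$* if for all $A$,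 all $t_0<T$ and all $\beta\in C^p([t_0,T];\mathbb R^n)$ the local error satisfies $\|\Phi_h(z)-\varphi_h(z)\|\le C h^{p+1}$, where $\varphi$ is the exact flow of $f^{[1]}+f^{[2]}$ and $C$ may be chosen uniformly for $z=(x,t)$ with $x$ in a bounded set and for all $h>0$ with $[t,t+h]\subseteq[t_0,T]$ for which the scheme evaluates $\beta$ only inside $[t_0,T]$, i.e. all frozen times $t+(b_1+\dots+b_{j-1})h$, $1\le j\le m$, lie in $[t_0,T]$ (automatic if $b\ge 0$ and $\sum_j b_j=1$). Finally, in formal power series in $h$ with noncommuting letters $L_1,L_2$, let $$\log\Big(\prod_{j=1}^m e^{a_jhL_1}e^{b_jhL_2}\Big)=h\,(e_{1_1}L_1+e_{1_2}L_2)+\cdots,$$ where the factors are ordered by increasing $j$ from left to right; put $D=[L_2,[L_1,L_2]]$ and for $k\ge3$ let $e_k$ be the coefficient of $h^k\,[L_2,[L_2,\dots,[L_2,D]]]$ ($k-3$ copies of $L_2$ in front of $D$) in this logarithm, i.e. the coefficient of the (up to a scalar) only commutator of degree $k$ containing $L_1$ exactly once. **Statement.** 1. (Order conditions.) Let $p\ge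 2$ be even. A symmetric scheme has order $p$ if and only if the $\tfrac p2+1$ conditions $e_{1_1}=e_{1_2}=1$ and $e_k=0$ for $k=3,5,\dots,p-1$ hold. 2. (Order 4, 5 stages, $m=3$.) The following two schemes are symmetric (of class a and b, respectively), have nonnegative step sizes, and have order $4$; each is the only scheme of its class with $m=3$ and nonnegative step sizes that has order $4$: * a) $a=(\tfrac16,\tfrac23,\tfrac16)$, $b=(\tfrac12,\tfrac12,0)$; * b) $a=(0,\tfrac12,\tfrac12)$, $b=(\tfrac{3-\sqrt3}6,\tfrac{\sqrt3}3,\tfrac{3-\sqrt3}6)$. 3. (Order 6, 7 stages, $m=4$.) The following two schemes are symmetric (of class a and b, respectively), have nonnegative step sizes, and have order $6$; each is the only scheme of its class with $m=4$ and nonnegative step sizes that has order $6$: * a) $a=(\tfrac1{12},\tfrac5{12},\tfrac5{12},\tfrac1{12})$, $b=(\tfrac{5-\sqrt5}{10},\tfrac{\sqrt5}5,\tfrac{5-\sqrt5}{10},0)$; * b) $a=(0,\tfrac5{18},\tfrac49,\tfrac5{18})$, $b=(\tfrac{5-\sqrt{15}}{10},\tfrac{\sqrt{15}}{10},\tfrac{\sqrt{15}}{10},\tfrac{5-\sqrt{15}}{10})$.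 4. (Even order $p$.) For every even $p\ge2$, the number $m=\tfrac p2+1$ is the minimal number of degrees of freedom for order $p$: each of the classes a) and b) contains a scheme with $m=\tfrac p2+1$ and nonnegative step sizes that has order $p$, and every symmetric scheme (with arbitrary real step sizes) that has order $p$ satisfies $m\ge\tfrac p2+1$. -/

import Mathlib

namespace PortSplitting

open Set Matrix

/-! ### Splitting schemes and their symmetry classes

A scheme with `2 m` step sizes is given by two tuples `a b : Fin m → ℝ`; the index `j : Fin m`
stands for the index `j + 1 ∈ {1, …, m}` of the usual notation. -/

/-- One step of size `h` of the scheme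
`φ²_{b_m h} ∘ φ¹_{a_m h} ∘ ⋯ ∘ φ²_{b_1 h} ∘ φ¹_{a_1 h}` applied to `z`. -/
def splittingStep {Z : Type*} {m : ℕ} (φ₁ φ₂ : ℝ → Z → Z) (a b : Fin m → ℝ) (h : ℝ) (z : Z) : Z :=
  Fin.foldl m (fun w j => φ₂ (b j * h) (φ₁ (a j * h) w)) z

/-- Class a): `a_i = a_{m+1-i}`, `b_m = 0` and `b_i = b_{m-i}` (with indices from `1` to `m`). -/
def IsClassA {m : ℕ} (a b : Fin m → ℝ) : Prop :=
  (∀ i j : Fin m, (i : ℕ) + j + 1 = m → a i = a j) ∧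
  (∀ i : Fin m, (i : ℕ) + 1 = m → b i = 0) ∧
  (∀ i j : Fin m, (i : ℕ) + j + 2 = m → b i = b j)

/-- Class b): `a_1 = 0`, `a_i = a_{m+2-i}` for `i ≥ 2`, and `b_i = b_{m+1-i}`
(with indices from `1` to `m`). -/
def IsClassB {m : ℕ} (a b : Fin m → ℝ) : Prop :=
  (∀ i : Fin m, (i : ℕ) = 0 → a i = 0) ∧
  (∀ i j : Fin m, (i : ℕ) + j = m → a i = a j) ∧
  (∀ i j : Fin m, (i : ℕ) + j + 1 = m → b i = b j)

/-- All step sizes are nonnegative. -/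
def StepsNonneg {m : ℕ} (a b : Fin m → ℝ) : Prop :=
  (∀ i, 0 ≤ a i) ∧ ∀ i, 0 ≤ b i

/-! ### The port-based decomposition of `ẋ = A x + β(t)` in the variable `z = (x, t)` -/

section Decomposition

variable {n : ℕ}

/-- The port part `f¹(x, t) = (β(t), 0)`. -/
def portField (β : ℝ → Fin n → ℝ) (z : (Fin n → ℝ) × ℝ) : (Fin n → ℝ) × ℝ := (β z.2, 0)

/-- The inner dynamics `f²(x, t) = (A x, 1)`. -/
def innerField (A : Matrix (Fin n) (Fin n) ℝ) (z : (Fin n → ℝ) × ℝ) : (Fin n → ℝ) × ℝ :=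
  (A *ᵥ z.1, 1)

/-- The flow of `portField β`: time is frozen. -/
def portFlow (β : ℝ → Fin n → ℝ) (τ : ℝ) (z : (Fin n → ℝ) × ℝ) : (Fin n → ℝ) × ℝ :=
  (z.1 + τ • β z.2, z.2)

/-- The flow of `innerField A`. -/
noncomputable def innerFlow (A : Matrix (Fin n) (Fin n) ℝ) (τ : ℝ) (z : (Fin n → ℝ) × ℝ) :
    (Fin n → ℝ) × ℝ :=
  (NormedSpace.exp (τ • A) *ᵥ z.1, z.2 + τ)

theorem portFlow_zero (β : ℝ → Fin n → ℝ) (z : (Fin n → ℝ) × ℝ) : portFlow β 0 z = z := by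
  simp [portFlow]

theorem innerFlow_zero (A : Matrix (Fin n) (Fin n) ℝ) (z : (Fin n → ℝ) × ℝ) :
    innerFlow A 0 z = z := by
  simp [innerFlow]

/-- `portFlow` really is the flow of `portField`. -/
theorem isIntegralCurve_portFlow (β : ℝ → Fin n → ℝ) (z : (Fin n → ℝ) × ℝ) :
    IsIntegralCurve (fun τ => portFlow β τ z) (fun _ => portField β) := by
  intro τ
  have h1 : HasDerivAt (fun τ : ℝ => z.1 + τ • β z.2) (β z.2) τ := by
    simpa using ((hasDerivAt_id τ).smul_const (β z.2)).const_add z.1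
  exact h1.prodMk (hasDerivAt_const τ z.2)

/-- `innerFlow` really is the flow of `innerField`. -/
theorem isIntegralCurve_innerFlow (A : Matrix (Fin n) (Fin n) ℝ) (z : (Fin n → ℝ) × ℝ) :
    IsIntegralCurve (fun τ => innerFlow A τ z) (fun _ => innerField A) := by
  intro τ
  have h1 : HasDerivAt (fun τ : ℝ => NormedSpace.exp (τ • A) *ᵥ z.1)
      (A *ᵥ (NormedSpace.exp (τ • A) *ᵥ z.1)) τ := by
    let : NormedRing (Matrix (Fin n) (Fin n) ℝ) := Matrix.linftyOpNormedRing
    let : NormedAlgebra ℝ (Matrix (Fin n) (Fin n) ℝ) := Matrix.linftyOpNormedAlgebra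
    have h := hasDerivAt_exp_smul_const' (𝕂 := ℝ) A τ
    let L : Matrix (Fin n) (Fin n) ℝ →ₗ[ℝ] (Fin n → ℝ) :=
      (Matrix.mulVecBilin ℝ ℝ).flip z.1
    have h2 := (LinearMap.toContinuousLinearMap L).hasFDerivAt.comp_hasDerivAt τ h
    rw [Matrix.mulVec_mulVec]
    exact h2
  have h2 : HasDerivAt (fun τ : ℝ => z.2 + τ) 1 τ := (hasDerivAt_id τ).const_add z.2
  exact h1.prodMk h2

/-- The scheme with step sizes `a`, `b` has order `p` for the port-based decomposition of systems
`ẋ = A x + β(t)` of dimension `n`: for every matrix `A` and every `β ∈ C^p([t₀, T])`, one step of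
size `h` and the exact solution of `ż = f¹(z) + f²(z)` started at the same point `(x, t)` differ
by at most `C h ^ (p + 1)`, with `C` uniform for bounded `x` and all admissible `t` and `h`.
The step is admissible if `[t, t + h] ⊆ [t₀, T]` and if the scheme evaluates `β` only in `[t₀, T]`,
at the frozen times `t + (b_1 + ⋯ + b_{j-1}) h`; for nonnegative `b` with sum `1` the latter follows
from the former. -/
def HasOrder (n : ℕ) {m : ℕ} (a b : Fin m → ℝ) (p : ℕ) : Prop :=
  ∀ (A : Matrix (Fin n) (Fin n) ℝ) (t₀ T : ℝ) (β : ℝ → Fin n → ℝ), t₀ < T →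
    ContDiffOn ℝ p β (Icc t₀ T) → ∀ R : ℝ, ∃ C : ℝ, ∀ (t h : ℝ) (z : ℝ → (Fin n → ℝ) × ℝ),
      t₀ ≤ t → 0 < h → t + h ≤ T →
      (∀ j : Fin m, t + (∑ i ∈ Finset.Iio j, b i) * h ∈ Icc t₀ T) →
      IsIntegralCurveOn z (fun _ w => portField β w + innerField A w) (Icc 0 h) →
      (z 0).2 = t → ‖(z 0).1‖ ≤ R →
      ‖splittingStep (portFlow β) (innerFlow A) a b h (z 0) - z h‖ ≤ C * h ^ (p + 1)

end Decomposition

/-! ### Order conditions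

Formal power series in `h` whose coefficients are noncommutative polynomials in the two letters
`L₁ = letter 0` and `L₂ = letter 1`. -/

/-- Noncommutative polynomials in `L₁` and `L₂`. -/
abbrev NCPoly : Type := FreeAlgebra ℝ (Fin 2)

/-- The letters `L₁ = letter 0` and `L₂ = letter 1`. -/
def letter (i : Fin 2) : NCPoly := FreeAlgebra.ι ℝ i

/-- The series `exp (c h L) = ∑ₖ (c ^ k / k!) L ^ k h ^ k`. -/
noncomputable def expSeries (c : ℝ) (L : NCPoly) : PowerSeries NCPoly :=
  PowerSeries.mk fun k => (c ^ k / (k.factorial : ℝ)) • L ^ k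

/-- The logarithm `log S = ∑_{r ≥ 1} ((-1) ^ (r + 1) / r) (S - 1) ^ r` of a series `S` with constant
term `1`; the coefficient of `h ^ k` only involves `r ≤ k`. -/
noncomputable def logSeries (S : PowerSeries NCPoly) : PowerSeries NCPoly :=
  PowerSeries.mk fun k => ∑ r ∈ Finset.Icc 1 k,
    ((-1 : ℝ) ^ (r + 1) / (r : ℝ)) • PowerSeries.coeff k ((S - 1) ^ r)

/-- The logarithm of
`exp (a_1 h L₁) exp (b_1 h L₂) ⋯ exp (a_m h L₁) exp (b_m h L₂)`. -/
noncomputable def schemeLog {m : ℕ} (a b : Fin m → ℝ) : PowerSeries NCPoly :=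
  logSeries (List.ofFn fun j => expSeries (a j) (letter 0) * expSeries (b j) (letter 1)).prod

/-- The coefficient of the word `w` in a noncommutative polynomial. -/
noncomputable def wordCoeff (w : List (Fin 2)) (x : NCPoly) : ℝ :=
  (FreeAlgebra.equivMonoidAlgebraFreeMonoid x).coeff (FreeMonoid.ofList w)

/-- The coefficient of `h L₁` in the logarithm of the scheme. -/
noncomputable def eOne {m : ℕ} (a b : Fin m → ℝ) : ℝ :=
  wordCoeff [0] (PowerSeries.coeff 1 (schemeLog a b))

/-- The coefficient of `h L₂` in the logarithm of the scheme. -/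
noncomputable def eTwo {m : ℕ} (a b : Fin m → ℝ) : ℝ :=
  wordCoeff [1] (PowerSeries.coeff 1 (schemeLog a b))

/-- The commutator `[L₂, [L₂, …, [L₂, D]]]` (with `r` copies of `L₂` in front of `D`), where
`D = [L₂, [L₁, L₂]]`. -/
def nestedD (r : ℕ) : NCPoly :=
  (fun x => ⁅letter 1, x⁆)^[r] ⁅letter 1, ⁅letter 0, letter 1⁆⁆

/-- The coefficient, for `k ≥ 3`, of `h ^ k [L₂, [L₂, …, [L₂, D]]]` (with `k - 3` copies of `L₂` in
front of `D`) in the logarithm of the scheme. Up to a scalar, this is the only commutator of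
degree `k` in which `L₁` occurs once. As it contains the word `L₂ ^ (k - 1) L₁` with
coefficient `-1` (see `wordCoeff_nestedD`) and commutators with at least two or no `L₁` do not
contain this word, the coefficient is minus that of this word. -/
noncomputable def eNested {m : ℕ} (a b : Fin m → ℝ) (k : ℕ) : ℝ :=
  -wordCoeff (List.replicate (k - 1) 1 ++ [0]) (PowerSeries.coeff k (schemeLog a b))

theorem wordCoeff_sub (w : List (Fin 2)) (x y : NCPoly) :
    wordCoeff w (x - y) = wordCoeff w x - wordCoeff w y := by
  simp [wordCoeff]

theorem equiv_letter (i : Fin 2) : FreeAlgebra.equivMonoidAlgebraFreeMonoid (letter i)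
    = MonoidAlgebra.single (FreeMonoid.of i) (1 : ℝ) := by
  simp [letter, FreeAlgebra.equivMonoidAlgebraFreeMonoid, MonoidAlgebra.of]

theorem wordCoeff_letter_mul (c i : Fin 2) (w : List (Fin 2)) (x : NCPoly) :
    wordCoeff (c :: w) (letter i * x) = if c = i then wordCoeff w x else 0 := by
  unfold wordCoeff
  rw [map_mul, equiv_letter]
  split_ifs with h
  · subst h
    rw [MonoidAlgebra.coeff_single_mul_eq_mul_coeff (m₂ := FreeMonoid.ofList w)]
    · simp
    · intro d _
      exact ⟨fun hd => List.cons_injective hd, fun hd => hd ▸ rfl⟩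
  · apply MonoidAlgebra.coeff_single_mul_of_forall_mul_ne
    intro d hd
    exact h (List.cons.inj hd).1.symm

theorem wordCoeff_mul_letter (c i : Fin 2) (w : List (Fin 2)) (x : NCPoly) :
    wordCoeff (w ++ [c]) (x * letter i) = if c = i then wordCoeff w x else 0 := by
  unfold wordCoeff
  rw [map_mul, equiv_letter]
  split_ifs with h
  · subst h
    rw [MonoidAlgebra.coeff_mul_single_eq_coeff_mul (m₂ := FreeMonoid.ofList w)]
    · simp
    · intro d _
      exact ⟨fun hd => List.append_cancel_right hd, fun hd => hd ▸ rfl⟩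
  · apply MonoidAlgebra.coeff_mul_single_of_forall_mul_ne
    intro d hd
    have h0 : FreeMonoid.toList d ++ [i] = w ++ [c] := hd
    have h1 := List.append_inj' h0 rfl
    exact h (by simpa using h1.2.symm)

theorem wordCoeff_lie (w : List (Fin 2)) (x : NCPoly) :
    wordCoeff (1 :: (w ++ [0])) ⁅letter 1, x⁆ = wordCoeff (w ++ [0]) x := by
  rw [Ring.lie_def, wordCoeff_sub, wordCoeff_letter_mul]
  have := wordCoeff_mul_letter 0 1 (1 :: w) x
  rw [List.cons_append] at this
  rw [this]
  simp

/-- The word `L₂ ^ (r + 2) L₁` has coefficient `-1` in `nestedD r`. -/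
theorem wordCoeff_nestedD (r : ℕ) :
    wordCoeff (List.replicate (r + 2) 1 ++ [0]) (nestedD r) = -1 := by
  induction r with
  | zero =>
    have h1 : wordCoeff (1 :: ([1] ++ [0])) ⁅letter 1, ⁅letter 0, letter 1⁆⁆ = -1 := by
      have h2 : wordCoeff [] (1 : NCPoly) = 1 := by
        simp [wordCoeff, MonoidAlgebra.one_def, FreeMonoid.ofList_nil]
      have h3 : wordCoeff [0] (letter 0) = 1 := by
        have := wordCoeff_letter_mul 0 0 [] 1
        rw [mul_one] at this
        rw [this, if_pos rfl, h2]
      have h4 : wordCoeff (1 :: [0]) (letter 0 * letter 1) = 0 := by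
        rw [wordCoeff_letter_mul]; simp
      have h5 : wordCoeff (1 :: [0]) (letter 1 * letter 0) = 1 := by
        rw [wordCoeff_letter_mul, if_pos rfl, h3]
      rw [wordCoeff_lie, Ring.lie_def, wordCoeff_sub]
      simp only [List.cons_append, List.nil_append]
      rw [h4, h5]; norm_num
    exact h1
  | succ r ih =>
    have h : nestedD (r + 1) = ⁅letter 1, nestedD r⁆ := Function.iterate_succ_apply' _ _ _
    rw [h, List.replicate_succ, List.cons_append, wordCoeff_lie, ih]

end PortSplitting

open PortSplitting

/-! In the variable `y = exp (-tA) x` the inner flow only advances time, and the port flow frozen at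
time `s` adds a multiple of `g(s) = exp (-sA) β(s)`. With the frozen times `c_j` one step gives `y +
h ∑ a_j g(t + c_j h)`, while the exact solution gives `y + ∫ g`. Hence order `p` means that `∑ b_j =
1` and that the quadrature formula with weights `a_j` and nodes `c_j` is exact for polynomials of
degree less than `p` (`hasOrder_iff_quadratureOrder`).

The coefficients `e_k` are read off from `L₁ ↦ X E₁₂`, `L₂ ↦ X E₁₁`. The scheme becomes a triangular
`2 × 2` matrix with off-diagonal entry `X M(X)`, where `M(X) = ∑ a_j exp (c_j X)`. If `∑ b_j = 1`,
taking the logarithm multiplies `M` by `B(X) = X / (exp X - 1)`. Exactness below degree `p` says `B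
M ≡ 1` modulo `X ^ p`. For symmetric schemes the nodes are invariant under `c ↦ 1 - c`, so `B M` is
even and only every second condition remains (`quadratureOrder_iff_eNested`).

The rest is classical quadrature. Class a) has both endpoints as nodes and class b) carries no
weight at `0`, so Lobatto and Gauss formulas give the schemes with `m = q + 1`. Fewer degrees of
freedom are impossible, since a nonzero polynomial that is nonnegative on `[0, 1]` and vanishes at
all nodes of nonzero weight would have too small a degree (`QuadratureOrder.succ_le`). -/

namespace PortSplitting

open Set Matrix

/-! ### Frozen times and the order of a quadrature formula -/

/-- The time, in units of the step size, at which the `j`-th port flow is frozen. -/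
def frozenTime {m : ℕ} (b : Fin m → ℝ) (j : Fin m) : ℝ := ∑ i ∈ Finset.Iio j, b i

theorem frozenTime_eq_sum_ite {m : ℕ} (b : Fin m → ℝ) (j : Fin m) :
    frozenTime b j = ∑ i, if i < j then b i else 0 := by
  rw [frozenTime, ← Finset.sum_filter]
  congr 1
  ext i
  simp

theorem frozenTime_castSucc {m : ℕ} (b : Fin (m + 1) → ℝ) (j : Fin m) :
    frozenTime b j.castSucc = frozenTime (fun i => b i.castSucc) j := by
  simp [frozenTime_eq_sum_ite, Fin.sum_univ_castSucc, not_lt.2 (Fin.le_last _)]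

theorem frozenTime_last {m : ℕ} (b : Fin (m + 1) → ℝ) :
    frozenTime b (Fin.last m) = ∑ i : Fin m, b i.castSucc := by
  simp [frozenTime_eq_sum_ite, Fin.sum_univ_castSucc, Fin.castSucc_lt_last]

/-- The quadrature formula with weights `a` and nodes `frozenTime b` on `[0, 1]` is exact for
polynomials of degree less than `p`, and the step sizes `b` sum up to `1`. -/
def QuadratureOrder {m : ℕ} (a b : Fin m → ℝ) (p : ℕ) : Prop :=
  ∑ j, b j = 1 ∧ ∀ k < p, ∑ j, a j * frozenTime b j ^ k = 1 / ((k : ℝ) + 1)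

/-! ### Taylor bounds -/

section Taylor

variable {E : Type*} [NormedAddCommGroup E] [NormedSpace ℝ E]

theorem hasDerivAt_smul_pow_sub (k : ℕ) (t s : ℝ) (v : E) :
    HasDerivAt (fun s : ℝ => (s - t) ^ (k + 1) • ((1 / ((k : ℝ) + 1)) • v)) ((s - t) ^ k • v) s := by
  have h := ((((hasDerivAt_id s).sub_const t).pow (k + 1)).smul_const ((1 / ((k : ℝ) + 1)) • v))
  have hk : (k : ℝ) + 1 ≠ 0 := by positivity
  have e : ((((k + 1 : ℕ) : ℝ) * (id s - t) ^ (k + 1 - 1) * 1) • (1 / ((k : ℝ) + 1)) • v)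
      = (s - t) ^ k • v := by
    rw [smul_smul, Nat.add_sub_cancel]
    congr 1
    push_cast
    simp only [id]
    field_simp
  exact e ▸ h

/-- Induction on `p`: the bound for the derivative is integrated by the mean value inequality. The
coefficients `v k t` need not be identified; it matters that they do not depend on `s` and that `s <
t` is allowed, since negative `b` can move frozen times before `t`. -/
theorem exists_taylor_bound {t₀ T : ℝ} (hT : t₀ < T) (p : ℕ) :
    ∀ F : ℝ → E, ContDiffOn ℝ p F (Icc t₀ T) → ∃ M : ℝ, 0 ≤ M ∧ ∃ v : ℕ → ℝ → E,
      ∀ s ∈ Icc t₀ T, ∀ t ∈ Icc t₀ T,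
        ‖F s - ∑ k ∈ Finset.range p, (s - t) ^ k • v k t‖ ≤ M * |s - t| ^ p := by
  induction p with
  | zero =>
    intro F hF
    obtain ⟨M, hM⟩ := isCompact_Icc.exists_bound_of_continuousOn hF.continuousOn
    refine ⟨M, (norm_nonneg _).trans (hM t₀ (left_mem_Icc.2 hT.le)), fun _ _ => 0, ?_⟩
    intro s hs t _
    simpa using hM s hs
  | succ p ih =>
    intro F hF
    obtain ⟨hd, -, hF'⟩ := (contDiffOn_succ_iff_derivWithin (𝕜 := ℝ) (n := p)
      (uniqueDiffOn_Icc hT)).1 (by exact_mod_cast hF)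
    obtain ⟨M, hM0, v, hv⟩ := ih _ hF'
    -- Coefficient `0` is the value of `F`; the later ones integrate the expansion of the
    -- derivative.
    refine ⟨M, hM0, fun k t => Nat.casesOn k (F t) fun k => (1 / ((k : ℝ) + 1)) • v k t, ?_⟩
    intro s hs t ht
    have hsub : uIcc t s ⊆ Icc t₀ T := uIcc_subset_Icc ht hs
    have key := (convex_uIcc t s).norm_image_sub_le_of_norm_hasDerivWithin_le
      (f := fun s => F s - ∑ k ∈ Finset.range p, (s - t) ^ (k + 1) • ((1 / ((k : ℝ) + 1)) • v k t))
      (f' := fun s => derivWithin F (Icc t₀ T) s - ∑ k ∈ Finset.range p, (s - t) ^ k • v k t)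
      (C := M * |s - t| ^ p) (x := t) (y := s) ?_ ?_ left_mem_uIcc right_mem_uIcc
    · rw [Finset.sum_range_succ']
      simp only [pow_zero, one_smul]
      simp only [sub_self, pow_succ, mul_zero, zero_smul, Finset.sum_const_zero, sub_zero,
        Real.norm_eq_abs] at key
      simp only [pow_succ]
      convert key using 1
      · congr 1; abel
      · ring
    · intro x hx
      refine HasDerivWithinAt.sub ((hd x (hsub hx)).hasDerivWithinAt.mono hsub) ?_
      exact HasDerivWithinAt.fun_sum fun k _ => (hasDerivAt_smul_pow_sub k t x _).hasDerivWithinAt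
    · intro x hx
      exact (hv x (hsub hx) t ht).trans (mul_le_mul_of_nonneg_left
        (pow_le_pow_left₀ (abs_nonneg _) (abs_sub_left_of_mem_uIcc hx) p) hM0)

end Taylor

/-! ### The interaction picture -/

section Order

variable {n : ℕ}

/-- The linear part of the system transformed away: `(x, t) ↦ exp (-t A) x`. -/
noncomputable def interactionState (A : Matrix (Fin n) (Fin n) ℝ) (z : (Fin n → ℝ) × ℝ) :
    Fin n → ℝ :=
  NormedSpace.exp (-z.2 • A) *ᵥ z.1

theorem exp_add_smul (A : Matrix (Fin n) (Fin n) ℝ) (s t : ℝ) :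
    NormedSpace.exp ((s + t) • A) = NormedSpace.exp (s • A) * NormedSpace.exp (t • A) := by
  rw [add_smul]
  exact Matrix.exp_add_of_commute _ _ (((Commute.refl A).smul_left s).smul_right t)

theorem exp_smul_interactionState (A : Matrix (Fin n) (Fin n) ℝ) (z : (Fin n → ℝ) × ℝ) :
    NormedSpace.exp (z.2 • A) *ᵥ interactionState A z = z.1 := by
  rw [interactionState, Matrix.mulVec_mulVec, ← exp_add_smul]
  simp

theorem interactionState_innerFlow (A : Matrix (Fin n) (Fin n) ℝ) (τ : ℝ)
    (z : (Fin n → ℝ) × ℝ) : interactionState A (innerFlow A τ z) = interactionState A z := by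
  simp only [interactionState, innerFlow]
  rw [Matrix.mulVec_mulVec, ← exp_add_smul]
  congr 3
  ring

theorem interactionState_portFlow (A : Matrix (Fin n) (Fin n) ℝ) (β : ℝ → Fin n → ℝ) (τ : ℝ)
    (z : (Fin n → ℝ) × ℝ) : interactionState A (portFlow β τ z)
      = interactionState A z + τ • interactionState A (β z.2, z.2) := by
  simp only [interactionState, portFlow]
  rw [Matrix.mulVec_add, Matrix.mulVec_smul]

theorem splittingStep_snd (A : Matrix (Fin n) (Fin n) ℝ) (β : ℝ → Fin n → ℝ) {m : ℕ}
    (a b : Fin m → ℝ) (h : ℝ) (z : (Fin n → ℝ) × ℝ) :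
    (splittingStep (portFlow β) (innerFlow A) a b h z).2 = z.2 + (∑ j, b j) * h := by
  induction m with
  | zero => simp [splittingStep]
  | succ m ih =>
    have := ih (fun i => a i.castSucc) (fun i => b i.castSucc)
    simp only [splittingStep] at this ⊢
    rw [Fin.foldl_succ_last, Fin.sum_univ_castSucc]
    simp only [innerFlow, portFlow] at this ⊢
    rw [this]
    ring

/-- The inner flow preserves `interactionState`, so only the port increments accumulate: the scheme
is a quadrature sum. -/
theorem interactionState_splittingStep (A : Matrix (Fin n) (Fin n) ℝ) (β : ℝ → Fin n → ℝ) {m : ℕ}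
    (a b : Fin m → ℝ) (h : ℝ) (z : (Fin n → ℝ) × ℝ) :
    interactionState A (splittingStep (portFlow β) (innerFlow A) a b h z) = interactionState A z +
      ∑ j, (a j * h) • interactionState A
        (β (z.2 + frozenTime b j * h), z.2 + frozenTime b j * h) := by
  induction m with
  | zero => simp [splittingStep]
  | succ m ih =>
    have h1 := ih (fun i => a i.castSucc) (fun i => b i.castSucc)
    have h2 := splittingStep_snd A β (fun i => a i.castSucc) (fun i => b i.castSucc) h z
    simp only [splittingStep] at h1 h2 ⊢
    rw [Fin.foldl_succ_last, Fin.sum_univ_castSucc, interactionState_innerFlow,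
      interactionState_portFlow, h1, h2]
    simp only [frozenTime_castSucc, frozenTime_last, add_assoc]

theorem contDiff_exp_smul_mulVec (A : Matrix (Fin n) (Fin n) ℝ) {p : ℕ} {β : ℝ → Fin n → ℝ}
    {s : Set ℝ} (hβ : ContDiffOn ℝ p β s) :
    ContDiffOn ℝ p (fun t => interactionState A (β t, t)) s := by
  let : NormedRing (Matrix (Fin n) (Fin n) ℝ) := Matrix.linftyOpNormedRing
  let : NormedAlgebra ℝ (Matrix (Fin n) (Fin n) ℝ) := Matrix.linftyOpNormedAlgebra
  have hE : ContDiff ℝ p (fun t : ℝ => NormedSpace.exp (-t • A)) := by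
    have h1 : ContDiff ℝ p (NormedSpace.exp : Matrix (Fin n) (Fin n) ℝ → _) :=
      contDiff_iff_contDiffAt.2 fun x => (NormedSpace.exp_analytic (𝕂 := ℝ) x).contDiffAt
    exact h1.comp (contDiff_neg.smul contDiff_const)
  have hij : ∀ i j, ContDiff ℝ p (fun t : ℝ => NormedSpace.exp (-t • A) i j) := by
    intro i j
    let L : Matrix (Fin n) (Fin n) ℝ →ₗ[ℝ] ℝ := Matrix.entryLinearMap ℝ ℝ i j
    exact (LinearMap.toContinuousLinearMap L).contDiff.comp hE
  rw [contDiffOn_pi]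
  intro i
  simp only [interactionState, Matrix.mulVec, dotProduct]
  refine ContDiffOn.sum fun j _ => ((hij i j).contDiffOn).mul ?_
  exact (contDiffOn_pi.1 hβ) j

theorem exists_bound_exp_smul (A : Matrix (Fin n) (Fin n) ℝ) (t₀ T : ℝ) : ∃ K : ℝ, 0 ≤ K ∧
    ∀ t ∈ Icc t₀ T, ∀ x, ‖NormedSpace.exp (t • A) *ᵥ x‖ ≤ K * ‖x‖ := by
  let : NormedRing (Matrix (Fin n) (Fin n) ℝ) := Matrix.linftyOpNormedRing
  let : NormedAlgebra ℝ (Matrix (Fin n) (Fin n) ℝ) := Matrix.linftyOpNormedAlgebra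
  have hE : Continuous (fun t : ℝ => NormedSpace.exp (t • A)) :=
    continuous_iff_continuousAt.2 fun t => (hasDerivAt_exp_smul_const (𝕂 := ℝ) A t).continuousAt
  obtain ⟨K, hK⟩ := (isCompact_Icc (a := t₀) (b := T)).exists_bound_of_continuousOn hE.continuousOn
  refine ⟨max K 0, le_max_right _ _, fun t ht x => ?_⟩
  refine (Matrix.linfty_opNorm_mulVec _ x).trans ?_
  gcongr
  exact (hK t ht).trans (le_max_left _ _)

theorem hasDerivAt_exp_neg_smul_apply (A : Matrix (Fin n) (Fin n) ℝ) (i j : Fin n) (t : ℝ) :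
    HasDerivAt (fun t : ℝ => NormedSpace.exp (-t • A) i j)
      (-(NormedSpace.exp (-t • A) * A) i j) t := by
  let : NormedRing (Matrix (Fin n) (Fin n) ℝ) := Matrix.linftyOpNormedRing
  let : NormedAlgebra ℝ (Matrix (Fin n) (Fin n) ℝ) := Matrix.linftyOpNormedAlgebra
  have h : HasDerivAt (fun t : ℝ => NormedSpace.exp (-t • A))
      ((-1 : ℝ) • (NormedSpace.exp (-t • A) * A)) t :=
    HasDerivAt.scomp t (hasDerivAt_exp_smul_const (𝕂 := ℝ) A (-t)) (hasDerivAt_neg t)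
  let L : Matrix (Fin n) (Fin n) ℝ →ₗ[ℝ] ℝ := Matrix.entryLinearMap ℝ ℝ i j
  have h2 := (LinearMap.toContinuousLinearMap L).hasFDerivAt.comp_hasDerivAt t h
  have e : LinearMap.toContinuousLinearMap L ((-1 : ℝ) • (NormedSpace.exp (-t • A) * A))
      = -(NormedSpace.exp (-t • A) * A) i j := by
    simp [L]
  exact e ▸ h2

/-- In the product rule the derivative of `exp (-tA)` contributes `-exp (-tA) A x`, which cancels
the linear part of the equation. The remaining right-hand side depends on time only. -/
theorem hasDerivWithinAt_interactionState {A : Matrix (Fin n) (Fin n) ℝ} {β : ℝ → Fin n → ℝ}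
    {z : ℝ → (Fin n → ℝ) × ℝ} {s : Set ℝ} {τ : ℝ}
    (hz : HasDerivWithinAt z (portField β (z τ) + innerField A (z τ)) s τ) :
    HasDerivWithinAt (fun τ => interactionState A (z τ))
      (interactionState A (β (z τ).2, (z τ).2)) s τ := by
  have h1 : HasDerivWithinAt (fun τ => (z τ).1) (β (z τ).2 + A *ᵥ (z τ).1) s τ := hz.fst
  have h2 : HasDerivWithinAt (fun τ => (z τ).2) (0 + 1) s τ := hz.snd
  rw [hasDerivWithinAt_pi] at h1 ⊢
  intro i
  have h3 := HasDerivWithinAt.fun_sum fun j (_ : j ∈ Finset.univ) =>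
    ((hasDerivAt_exp_neg_smul_apply A i j (z τ).2).comp_hasDerivWithinAt τ h2).mul (h1 j)
  refine h3.congr_deriv ?_
  have e : interactionState A (β (z τ).2, (z τ).2) i
      = -((NormedSpace.exp (-(z τ).2 • A) * A) *ᵥ (z τ).1) i
        + (NormedSpace.exp (-(z τ).2 • A) *ᵥ (β (z τ).2 + A *ᵥ (z τ).1)) i := by
    simp [interactionState, Matrix.mulVec_add, Matrix.mulVec_mulVec]
  rw [e]
  simp [Matrix.mulVec, dotProduct, Finset.sum_add_distrib]

end Order

/-! ### Order of the scheme and order of the quadrature formula -/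

section Order

variable {n : ℕ}

/-- Returns from the interaction picture. Both states must carry the same time, which is where `∑
b_j = 1` enters. -/
theorem norm_sub_le_of_interactionState {A : Matrix (Fin n) (Fin n) ℝ} {K t : ℝ}
    (hK : ∀ x, ‖NormedSpace.exp (t • A) *ᵥ x‖ ≤ K * ‖x‖) {y z : (Fin n → ℝ) × ℝ}
    (hy : y.2 = t) (hz : z.2 = t) :
    ‖y - z‖ ≤ K * ‖interactionState A y - interactionState A z‖ := by
  have h1 : y - z = (NormedSpace.exp (t • A) *ᵥ
      (interactionState A y - interactionState A z), 0) := by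
    rw [Matrix.mulVec_sub]
    nth_rw 1 [← hy]
    rw [← hz, exp_smul_interactionState, exp_smul_interactionState]
    ext <;> simp [hy, hz]
  rw [h1, Prod.norm_def, norm_zero, max_eq_left (norm_nonneg _)]
  exact hK _

theorem snd_eq_of_isIntegralCurveOn {A : Matrix (Fin n) (Fin n) ℝ} {β : ℝ → Fin n → ℝ}
    {z : ℝ → (Fin n → ℝ) × ℝ} {h : ℝ}
    (hz : IsIntegralCurveOn z (fun _ w => portField β w + innerField A w) (Icc 0 h))
    {s : ℝ} (hs : s ∈ Icc 0 h) : (z s).2 = (z 0).2 + s := by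
  have h0 : (0 : ℝ) ∈ Icc 0 h := left_mem_Icc.2 (hs.1.trans hs.2)
  have key := (convex_Icc (0 : ℝ) h).norm_image_sub_le_of_norm_hasDerivWithin_le
    (f := fun s => (z s).2 - s) (f' := fun _ => 0) (C := 0) (x := 0) (y := s)
    (fun x hx => by
      have h1 : HasDerivWithinAt (fun τ => (z τ).2) (0 + 1) (Icc 0 h) x := (hz x hx).snd
      exact (h1.fun_sub (hasDerivWithinAt_id x _)).congr_deriv (by simp)) (by simp) h0 hs
  rw [zero_mul, norm_le_zero_iff] at key
  linarith

theorem norm_integral_sub_le_of_taylor_bound {E : Type*} [NormedAddCommGroup E] [NormedSpace ℝ E]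
    {w f : ℝ → E} {h M : ℝ} {p : ℕ} {v : ℕ → E} (hh : 0 ≤ h) (hM : 0 ≤ M)
    (hw : ∀ s ∈ Icc 0 h, HasDerivWithinAt w (f s) (Icc 0 h) s)
    (hf : ∀ s ∈ Icc 0 h, ‖f s - ∑ k ∈ Finset.range p, s ^ k • v k‖ ≤ M * |s| ^ p) :
    ‖w h - w 0 - ∑ k ∈ Finset.range p, h ^ (k + 1) • ((1 / ((k : ℝ) + 1)) • v k)‖
      ≤ M * h ^ (p + 1) := by
  have key := (convex_Icc (0 : ℝ) h).norm_image_sub_le_of_norm_hasDerivWithin_le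
    (f := fun s => w s - ∑ k ∈ Finset.range p, s ^ (k + 1) • ((1 / ((k : ℝ) + 1)) • v k))
    (f' := fun s => f s - ∑ k ∈ Finset.range p, s ^ k • v k)
    (C := M * h ^ p) (x := 0) (y := h) ?_ ?_ (left_mem_Icc.2 hh) (right_mem_Icc.2 hh)
  · simp only [ne_eq, Nat.add_eq_zero_iff, one_ne_zero, and_false, not_false_eq_true, zero_pow,
      zero_smul, Finset.sum_const_zero, sub_zero, Real.norm_of_nonneg hh] at key
    rw [sub_right_comm, pow_succ, ← mul_assoc]
    exact key
  · intro s hs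
    refine (hw s hs).sub (HasDerivWithinAt.fun_sum fun k _ => ?_)
    simpa using (hasDerivAt_smul_pow_sub k 0 s (v k)).hasDerivWithinAt
  · intro s hs
    refine (hf s hs).trans (mul_le_mul_of_nonneg_left ?_ hM)
    exact pow_le_pow_left₀ (abs_nonneg _) (abs_le.2 ⟨by linarith [hs.1], hs.2⟩) p

theorem norm_quadrature_sub_le_of_taylor_bound {E : Type*} [NormedAddCommGroup E] [NormedSpace ℝ E]
    {m : ℕ} {a b : Fin m → ℝ} {p : ℕ} (hq : QuadratureOrder a b p) {g : Fin m → E} {h M : ℝ}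
    {v : ℕ → E} (hh : 0 ≤ h)
    (hg : ∀ j, ‖g j - ∑ k ∈ Finset.range p, (frozenTime b j * h) ^ k • v k‖
      ≤ M * |frozenTime b j * h| ^ p) :
    ‖∑ j, (a j * h) • g j - ∑ k ∈ Finset.range p, h ^ (k + 1) • ((1 / ((k : ℝ) + 1)) • v k)‖
      ≤ (∑ j, |a j| * |frozenTime b j| ^ p) * M * h ^ (p + 1) := by
  have e : ∑ k ∈ Finset.range p, h ^ (k + 1) • ((1 / ((k : ℝ) + 1)) • v k)
      = ∑ j, (a j * h) • ∑ k ∈ Finset.range p, (frozenTime b j * h) ^ k • v k := by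
    simp_rw [Finset.smul_sum]
    rw [Finset.sum_comm]
    refine Finset.sum_congr rfl fun k hk => ?_
    rw [← hq.2 k (Finset.mem_range.1 hk), Finset.sum_smul, Finset.smul_sum]
    refine Finset.sum_congr rfl fun j _ => ?_
    simp only [smul_smul]
    congr 1
    ring
  rw [e, ← Finset.sum_sub_distrib, Finset.sum_mul, Finset.sum_mul]
  refine (norm_sum_le _ _).trans (Finset.sum_le_sum fun j _ => ?_)
  rw [← smul_sub, norm_smul]
  refine (mul_le_mul_of_nonneg_left (hg j) (norm_nonneg _)).trans (le_of_eq ?_)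
  rw [Real.norm_eq_abs, abs_mul, abs_mul, abs_of_nonneg hh]
  ring

/-- Exactness makes the quadrature sum and the integral agree on the Taylor polynomial of `exp (-sA)
β(s)` at `t`; both are compared with that common value. -/
theorem QuadratureOrder.hasOrder {m : ℕ} {a b : Fin m → ℝ} {p : ℕ} (hq : QuadratureOrder a b p)
    (n : ℕ) : HasOrder n a b p := by
  intro A t₀ T β hT hβ R
  obtain ⟨M, hM0, v, hv⟩ := exists_taylor_bound hT p _ (contDiff_exp_smul_mulVec A hβ)
  obtain ⟨K, hK0, hK⟩ := exists_bound_exp_smul A t₀ T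
  refine ⟨K * ((∑ j, |a j| * |frozenTime b j| ^ p) * M + M), ?_⟩
  intro t h z ht hh hth hc hz hz0 _
  have hsnd : ∀ s ∈ Icc 0 h, (z s).2 = t + s := fun s hs => by
    rw [snd_eq_of_isIntegralCurveOn hz hs, hz0]
  have htmem : t ∈ Icc t₀ T := ⟨ht, by linarith⟩
  have hmem : ∀ s ∈ Icc 0 h, t + s ∈ Icc t₀ T := fun s hs =>
    ⟨by linarith [hs.1], by linarith [hs.2]⟩
  have hh0 : h ∈ Icc 0 h := right_mem_Icc.2 hh.le
  have h1 := norm_integral_sub_le_of_taylor_bound (w := fun s => interactionState A (z s))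
    (f := fun s => interactionState A (β (t + s), t + s)) (v := fun k => v k t) (p := p)
    hh.le hM0
    (fun s hs => by
      have := hasDerivWithinAt_interactionState (hz s hs)
      rwa [hsnd s hs] at this)
    (fun s hs => by simpa using hv (t + s) (hmem s hs) t htmem)
  have h2 := norm_quadrature_sub_le_of_taylor_bound hq (M := M) (v := fun k => v k t)
    (g := fun j => interactionState A (β (t + frozenTime b j * h), t + frozenTime b j * h))
    hh.le (fun j => by
      simpa using hv (t + frozenTime b j * h) (hc j) t htmem)
  refine (norm_sub_le_of_interactionState (hK (t + h) (hmem h hh0)) ?_ (hsnd h hh0)).trans ?_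
  · rw [splittingStep_snd, hz0, hq.1, one_mul]
  · rw [mul_assoc]
    refine mul_le_mul_of_nonneg_left ?_ hK0
    rw [interactionState_splittingStep, hz0, add_mul]
    refine le_trans (le_of_eq_of_le ?_ (norm_sub_le _ _)) (add_le_add h2 h1)
    congr 1
    abel

/-! ### Necessity of the quadrature conditions -/

theorem eq_zero_of_forall_abs_mul_pow_le {x C δ : ℝ} {k p : ℕ} (hkp : k < p) (hδ : 0 < δ)
    (H : ∀ h, 0 < h → h ≤ δ → |x| * h ^ k ≤ C * h ^ p) : x = 0 := by
  by_contra hx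
  have hx' : 0 < |x| := abs_pos.2 hx
  -- The last bound forces `|C| * h < |x|`.
  set h := min (min δ 1) (|x| / (2 * (|C| + 1))) with hh
  have hC : 0 < 2 * (|C| + 1) := by positivity
  have h0 : 0 < h := lt_min (lt_min hδ one_pos) (by positivity)
  have hδ' : h ≤ δ := (min_le_left _ _).trans (min_le_left _ _)
  have h1 : h ≤ 1 := (min_le_left _ _).trans (min_le_right _ _)
  have h2 : h * (2 * (|C| + 1)) ≤ |x| := (le_div_iff₀ hC).1 (min_le_right _ _)
  have h3 := H h h0 hδ'
  have h4 : C * h ^ p ≤ |C| * (h ^ k * h) := by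
    refine (mul_le_mul_of_nonneg_right (le_abs_self C) (by positivity)).trans ?_
    rw [← pow_succ]
    exact mul_le_mul_of_nonneg_left (pow_le_pow_of_le_one h0.le h1 hkp) (abs_nonneg _)
  have h5 : 0 < h ^ k := by positivity
  have h6 : |x| * h ^ k ≤ (|C| * h) * h ^ k := by linarith
  have h7 : |x| ≤ |C| * h := le_of_mul_le_mul_right h6 h5
  nlinarith [abs_nonneg C]

/-- Test problem `A = 0`, `β(s) = s ^ k`, started at the origin: its local error is the defect of
the `k`-th moment times `h ^ (k + 1)`, and its time component gives the defect of `∑ b_j`. -/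
theorem exists_abs_le_of_hasOrder {m : ℕ} {a b : Fin m → ℝ} {p : ℕ} (hn : 1 ≤ n)
    (ho : HasOrder n a b p) (k : ℕ) : ∃ C δ : ℝ, 0 < δ ∧ ∀ h, 0 < h → h ≤ δ →
      |∑ j, b j - 1| * h ≤ C * h ^ (p + 1) ∧
      |∑ j, a j * frozenTime b j ^ k - 1 / ((k : ℝ) + 1)| * h ^ (k + 1) ≤ C * h ^ (p + 1) := by
  have : Nonempty (Fin n) := ⟨⟨0, hn⟩⟩
  obtain ⟨C, hC⟩ := ho 0 (-1) 1 (fun s _ => s ^ k) (by norm_num)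
    (contDiffOn_pi.2 fun _ => (contDiff_id.pow k).contDiffOn) 0
  -- For `h ≤ 1 / B` all frozen times stay in `[-1, 1]`, also when some nodes are negative or exceed
  -- `1`.
  set B : ℝ := 1 + ∑ j, |frozenTime b j| with hB
  have hB1 : 1 ≤ B := by
    have : 0 ≤ ∑ j, |frozenTime b j| := Finset.sum_nonneg fun _ _ => abs_nonneg _
    linarith
  refine ⟨C, 1 / B, by positivity, fun h h0 hδ => ?_⟩
  have hBh : B * h ≤ 1 := by
    rw [le_div_iff₀ (by linarith)] at hδ
    linarith
  have hh1 : h ≤ 1 := by nlinarith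
  set z : ℝ → (Fin n → ℝ) × ℝ := fun s => (fun _ => s ^ (k + 1) / ((k : ℝ) + 1), s) with hz
  have hk : (k : ℝ) + 1 ≠ 0 := by positivity
  have hz0 : z 0 = 0 := by
    ext <;> simp [hz]
  have key := hC 0 h z (by norm_num) h0 (by linarith) ?_ ?_ (by simp [hz0]) (by simp [hz0])
  · have hfst : (splittingStep (portFlow fun s _ => s ^ k)
        (innerFlow (0 : Matrix (Fin n) (Fin n) ℝ)) a b h (z 0)).1
          = fun _ => (∑ j, a j * frozenTime b j ^ k) * h ^ (k + 1) := by
      have h1 := interactionState_splittingStep (0 : Matrix (Fin n) (Fin n) ℝ)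
        (fun s _ => s ^ k) a b h (z 0)
      simp only [interactionState, smul_zero, NormedSpace.exp_zero, Matrix.one_mulVec, hz0] at h1
      rw [hz0, h1]
      ext i
      simp only [Prod.fst_zero, Prod.snd_zero, zero_add, Finset.sum_apply, Pi.smul_apply,
        smul_eq_mul, Finset.sum_mul]
      refine Finset.sum_congr rfl fun j _ => ?_
      ring
    constructor
    · refine le_trans (le_of_eq ?_) ((norm_snd_le _).trans key)
      rw [Prod.snd_sub, splittingStep_snd, hz0]
      simp only [hz, Prod.snd_zero, zero_add, Real.norm_eq_abs]
      rw [← sub_one_mul, abs_mul, abs_of_pos h0]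
    · refine le_trans (le_of_eq ?_) ((norm_fst_le _).trans key)
      rw [Prod.fst_sub, hfst]
      have e : ((fun _ => (∑ j, a j * frozenTime b j ^ k) * h ^ (k + 1)) - (z h).1 : Fin n → ℝ)
          = fun _ => (∑ j, a j * frozenTime b j ^ k - 1 / ((k : ℝ) + 1)) * h ^ (k + 1) := by
        ext i
        simp only [hz, Pi.sub_apply]
        ring
      rw [e, pi_norm_const, Real.norm_eq_abs, abs_mul, abs_of_pos (pow_pos h0 _)]
  · intro j
    have h1 : |frozenTime b j| ≤ B := by
      have := Finset.single_le_sum (f := fun j => |frozenTime b j|) (fun _ _ => abs_nonneg _)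
        (Finset.mem_univ j)
      linarith
    have h2 : |frozenTime b j * h| ≤ 1 := by
      rw [abs_mul, abs_of_pos h0]
      nlinarith
    rw [zero_add]
    exact abs_le.1 h2
  · intro s _
    refine HasDerivAt.hasDerivWithinAt ?_
    have h1 : HasDerivAt (fun s : ℝ => fun _ : Fin n => s ^ (k + 1) / ((k : ℝ) + 1))
        (fun _ => s ^ k) s := by
      rw [hasDerivAt_pi]
      intro i
      refine ((hasDerivAt_pow (k + 1) s).div_const ((k : ℝ) + 1)).congr_deriv ?_
      rw [Nat.add_sub_cancel]
      push_cast
      field_simp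
    have h2 := h1.prodMk (hasDerivAt_id s)
    refine h2.congr_deriv ?_
    ext <;> simp [portField, innerField, hz]

theorem hasOrder_iff_quadratureOrder {m : ℕ} {a b : Fin m → ℝ} {p : ℕ} (hn : 1 ≤ n)
    (hp : 1 ≤ p) : HasOrder n a b p ↔ QuadratureOrder a b p := by
  refine ⟨fun ho => ⟨?_, fun k hk => ?_⟩, fun hq => hq.hasOrder n⟩
  · obtain ⟨C, δ, hδ, H⟩ := exists_abs_le_of_hasOrder hn ho 0
    refine sub_eq_zero.1 (eq_zero_of_forall_abs_mul_pow_le (C := C) (k := 1) (p := p + 1) (by omega) hδ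
      fun h h0 hd => ?_)
    simpa using (H h h0 hd).1
  · obtain ⟨C, δ, hδ, H⟩ := exists_abs_le_of_hasOrder hn ho k
    exact sub_eq_zero.1 (eq_zero_of_forall_abs_mul_pow_le (C := C) (k := k + 1) (p := p + 1) (by omega) hδ
      fun h h0 hd => (H h h0 hd).2)

end Order

/-! ### The coefficients of words with exactly one `L₁`, at the end -/

/-- The representation `L₁ ↦ X E₁₂`, `L₂ ↦ X E₁₁` of noncommutative polynomials. It only sees the
words `L₂ ^ k` and `L₂ ^ k L₁`. -/
noncomputable def wordRep : NCPoly →ₐ[ℝ] Matrix (Fin 2) (Fin 2) (Polynomial ℝ) :=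
  FreeAlgebra.lift ℝ ![!![0, Polynomial.X; 0, 0], !![Polynomial.X, 0; 0, 0]]

theorem wordRep_letter_zero : wordRep (letter 0) = !![0, Polynomial.X; 0, 0] := by
  simp [wordRep, letter]

theorem wordRep_letter_one : wordRep (letter 1) = !![Polynomial.X, 0; 0, 0] := by
  simp [wordRep, letter]

theorem wordCoeff_add (w : List (Fin 2)) (x y : NCPoly) :
    wordCoeff w (x + y) = wordCoeff w x + wordCoeff w y := by
  simp [wordCoeff]

theorem wordCoeff_smul (w : List (Fin 2)) (r : ℝ) (x : NCPoly) :
    wordCoeff w (r • x) = r * wordCoeff w x := by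
  simp [wordCoeff]

theorem wordCoeff_one (w : List (Fin 2)) : wordCoeff w 1 = if w = [] then 1 else 0 := by
  simp only [wordCoeff, map_one, MonoidAlgebra.one_def, MonoidAlgebra.coeff_single]
  by_cases h : w = []
  · subst h
    simp [FreeMonoid.ofList_nil]
  · rw [if_neg h, Finsupp.single_eq_of_ne]
    exact h

theorem wordCoeff_nil_letter_mul (i : Fin 2) (x : NCPoly) : wordCoeff [] (letter i * x) = 0 := by
  unfold wordCoeff
  rw [map_mul, equiv_letter]
  apply MonoidAlgebra.coeff_single_mul_of_forall_mul_ne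
  intro d hd
  exact List.cons_ne_nil _ _ hd

/-- Noncommutative polynomials are spanned by words, built up by left multiplication. -/
theorem NCPoly.induction_letter_mul {S : NCPoly → Prop} (one : S 1)
    (smul : ∀ (r : ℝ) x, S x → S (r • x)) (add : ∀ x y, S x → S y → S (x + y))
    (letter_mul : ∀ i x, S x → S (letter i * x)) (x : NCPoly) : S x := by
  suffices h : ∀ y, S y → S (x * y) by simpa using h 1 one
  induction x using FreeAlgebra.induction with
  | grade0 r => exact fun y hy => by rw [← Algebra.smul_def]; exact smul r y hy
  | grade1 i => exact fun y hy => letter_mul i y hy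
  | mul a b ha hb => exact fun y hy => by rw [mul_assoc]; exact ha _ (hb _ hy)
  | add a b ha hb => exact fun y hy => by rw [add_mul]; exact add _ _ (ha _ hy) (hb _ hy)

/-- All entries are treated together because left multiplication mixes them: `L₁` moves the
empty-word coefficient from entry `(1, 1)` to `(0, 1)`, and `L₂` multiplies the top row by `X`. -/
theorem wordRep_apply (x : NCPoly) :
    wordRep x 1 0 = 0 ∧ wordRep x 1 1 = Polynomial.C (wordCoeff [] x) ∧
      (wordRep x 0 1).coeff 0 = 0 ∧
      (∀ k, (wordRep x 0 1).coeff (k + 1) = wordCoeff (List.replicate k 1 ++ [0]) x) ∧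
      ∀ k, (wordRep x 0 0).coeff k = wordCoeff (List.replicate k 1) x := by
  induction x using NCPoly.induction_letter_mul with
  | one =>
    refine ⟨by simp, by simp [wordCoeff_one], by simp, fun k => by simp [wordCoeff_one],
      fun k => ?_⟩
    simp [wordCoeff_one, Polynomial.coeff_one]
  | smul r x h =>
    obtain ⟨h1, h2, h3, h4, h5⟩ := h
    refine ⟨?_, ?_, ?_, fun k => ?_, fun k => ?_⟩ <;>
      simp [wordCoeff_smul, h1, h2, h3, h4, h5, Polynomial.smul_eq_C_mul]
  | add x y h h' =>
    obtain ⟨h1, h2, h3, h4, h5⟩ := h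
    obtain ⟨h1', h2', h3', h4', h5'⟩ := h'
    refine ⟨?_, ?_, ?_, fun k => ?_, fun k => ?_⟩ <;>
      simp [wordCoeff_add, h1, h2, h3, h4, h5, h1', h2', h3', h4', h5']
  | letter_mul i x h =>
    obtain ⟨h1, h2, h3, h4, h5⟩ := h
    rw [map_mul]
    fin_cases i
    · simp only [Fin.zero_eta, Fin.isValue, wordRep_letter_zero, Matrix.mul_apply,
        Fin.sum_univ_two]
      refine ⟨?_, ?_, ?_, fun k => ?_, fun k => ?_⟩
      · simp
      · simp [wordCoeff_nil_letter_mul]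
      · simp
      · simp only [h2, of_apply, cons_val', cons_val_zero, cons_val_one, zero_mul, zero_add,
          cons_val_fin_one, Polynomial.coeff_X_mul, Polynomial.coeff_C]
        cases k with
        | zero => simp [wordCoeff_letter_mul]
        | succ k => simp [List.replicate_succ, wordCoeff_letter_mul]
      · simp only [h1, of_apply, cons_val', cons_val_zero, cons_val_one, zero_mul, zero_add,
          cons_val_fin_one, mul_zero, Polynomial.coeff_zero]
        cases k with
        | zero => simp [wordCoeff_nil_letter_mul]
        | succ k => simp [List.replicate_succ, wordCoeff_letter_mul]
    · simp only [Fin.mk_one, Fin.isValue, wordRep_letter_one, Matrix.mul_apply,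
        Fin.sum_univ_two]
      refine ⟨?_, ?_, ?_, fun k => ?_, fun k => ?_⟩
      · simp
      · simp [wordCoeff_nil_letter_mul]
      · simp
      · simp only [of_apply, cons_val', cons_val_zero, cons_val_one, zero_mul, add_zero,
          cons_val_fin_one, Polynomial.coeff_X_mul]
        cases k with
        | zero => simp [h3, wordCoeff_letter_mul]
        | succ k => simp [h4, List.replicate_succ, wordCoeff_letter_mul]
      · simp only [of_apply, cons_val', cons_val_zero, cons_val_one, zero_mul, add_zero,
          cons_val_fin_one]
        cases k with
        | zero => simp [wordCoeff_nil_letter_mul]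
        | succ k => simp [h5, List.replicate_succ, wordCoeff_letter_mul]

/-- The image of the series `S` under `wordRep` is homogeneous: the coefficient of `h ^ k` is
`X ^ k` times the coefficients of degree `k` of the entries of `T`. -/
def IsWordRep (S : PowerSeries NCPoly) (T : Matrix (Fin 2) (Fin 2) (PowerSeries ℝ)) : Prop :=
  ∀ k i j, wordRep (PowerSeries.coeff k S) i j
    = Polynomial.monomial k (PowerSeries.coeff k (T i j))

namespace IsWordRep

theorem one : IsWordRep 1 1 := by
  intro k i j
  rw [PowerSeries.coeff_one]
  by_cases hk : k = 0
  · subst hk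
    by_cases hij : i = j
    · subst hij
      simp
    · simp [Matrix.one_apply_ne hij]
  · by_cases hij : i = j
    · subst hij
      simp [hk, PowerSeries.coeff_one]
    · simp [Matrix.one_apply_ne hij, hk]

theorem sub {S S' : PowerSeries NCPoly} {T T' : Matrix (Fin 2) (Fin 2) (PowerSeries ℝ)}
    (h : IsWordRep S T) (h' : IsWordRep S' T') : IsWordRep (S - S') (T - T') := by
  intro k i j
  simp [h k i j, h' k i j]

theorem mul {S S' : PowerSeries NCPoly} {T T' : Matrix (Fin 2) (Fin 2) (PowerSeries ℝ)}
    (h : IsWordRep S T) (h' : IsWordRep S' T') : IsWordRep (S * S') (T * T') := by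
  intro k i j
  simp only [PowerSeries.coeff_mul, map_sum, map_mul, Matrix.sum_apply, Matrix.mul_apply]
  rw [Finset.sum_comm]
  refine Finset.sum_congr rfl fun l _ => Finset.sum_congr rfl fun x hx => ?_
  rw [h, h', Polynomial.monomial_mul_monomial, Finset.HasAntidiagonal.mem_antidiagonal.1 hx]

theorem pow {S : PowerSeries NCPoly} {T : Matrix (Fin 2) (Fin 2) (PowerSeries ℝ)}
    (h : IsWordRep S T) (r : ℕ) : IsWordRep (S ^ r) (T ^ r) := by
  induction r with
  | zero => simpa using one
  | succ r ih => rw [pow_succ, pow_succ]; exact ih.mul h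

/-- Powers of `S - 1` stay homogeneous, so the logarithm can be computed with matrices over
commutative power series. -/
theorem logSeries {S : PowerSeries NCPoly} {T : Matrix (Fin 2) (Fin 2) (PowerSeries ℝ)}
    (h : IsWordRep S T) (k : ℕ) (i j : Fin 2) :
    (wordRep (PowerSeries.coeff k (logSeries S)) i j).coeff k
      = ∑ r ∈ Finset.Icc 1 k, ((-1 : ℝ) ^ (r + 1) / (r : ℝ)) *
        PowerSeries.coeff k (((T - 1) ^ r) i j) := by
  simp only [PortSplitting.logSeries, PowerSeries.coeff_mk, map_sum, map_smul, Matrix.sum_apply,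
    Matrix.smul_apply, Polynomial.finsetSum_coeff, Polynomial.coeff_smul, smul_eq_mul]
  refine Finset.sum_congr rfl fun r _ => ?_
  rw [(h.sub one).pow r k i j, Polynomial.coeff_monomial_same]

end IsWordRep

/-- The series `exp (c X)`. -/
noncomputable def expScaled (c : ℝ) : PowerSeries ℝ := PowerSeries.rescale c (PowerSeries.exp ℝ)

theorem coeff_expScaled (c : ℝ) (k : ℕ) :
    PowerSeries.coeff k (expScaled c) = c ^ k / (k.factorial : ℝ) := by
  simp [expScaled, PowerSeries.coeff_rescale, div_eq_mul_inv]

theorem expScaled_zero : expScaled 0 = 1 := by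
  ext k
  rw [coeff_expScaled, PowerSeries.coeff_one]
  cases k <;> simp

theorem expScaled_add (c d : ℝ) : expScaled (c + d) = expScaled c * expScaled d :=
  (PowerSeries.exp_mul_exp_eq_exp_add c d).symm

theorem isWordRep_expSeries_letter_zero (a : ℝ) :
    IsWordRep (expSeries a (letter 0)) !![1, PowerSeries.C a * PowerSeries.X; 0, 1] := by
  intro k i j
  simp only [expSeries, PowerSeries.coeff_mk, map_smul, map_pow, wordRep_letter_zero]
  match k with
  | 0 => fin_cases i <;> fin_cases j <;> simp
  | 1 =>
    fin_cases i <;> fin_cases j <;>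
      simp [PowerSeries.coeff_one, Polynomial.smul_eq_C_mul,
        ← Polynomial.C_mul_X_eq_monomial]
  | k + 2 =>
    have h : (!![0, Polynomial.X; 0, 0] : Matrix (Fin 2) (Fin 2) (Polynomial ℝ)) ^ (k + 2) = 0 := by
      rw [pow_add]
      have : (!![0, Polynomial.X; 0, 0] : Matrix (Fin 2) (Fin 2) (Polynomial ℝ)) ^ 2 = 0 := by
        rw [pow_two]; ext i j; fin_cases i <;> fin_cases j <;> simp
      rw [this, mul_zero]
    rw [h]
    fin_cases i <;> fin_cases j <;> simp [PowerSeries.coeff_one]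

theorem isWordRep_expSeries_letter_one (b : ℝ) :
    IsWordRep (expSeries b (letter 1)) !![expScaled b, 0; 0, 1] := by
  intro k i j
  simp only [expSeries, PowerSeries.coeff_mk, map_smul, map_pow, wordRep_letter_one]
  cases k with
  | zero => fin_cases i <;> fin_cases j <;> simp [coeff_expScaled]
  | succ k =>
    have h : (!![Polynomial.X, 0; 0, 0] : Matrix (Fin 2) (Fin 2) (Polynomial ℝ)) ^ (k + 1)
        = !![Polynomial.X ^ (k + 1), 0; 0, 0] := by
      induction k with
      | zero => simp
      | succ k ih =>
        rw [pow_succ, ih]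
        ext i j; fin_cases i <;> fin_cases j <;> simp [pow_succ]
    rw [h]
    fin_cases i <;> fin_cases j <;>
      simp [PowerSeries.coeff_one, coeff_expScaled, Polynomial.smul_eq_C_mul,
        Polynomial.C_mul_X_pow_eq_monomial]

/-- The exponential generating function `∑ a_j exp (c_j X)` of the moments of the quadrature formula
with weights `a` and nodes `frozenTime b`. -/
noncomputable def momentSeries {m : ℕ} (a b : Fin m → ℝ) : PowerSeries ℝ :=
  ∑ j, PowerSeries.C (a j) * expScaled (frozenTime b j)

theorem coeff_momentSeries {m : ℕ} (a b : Fin m → ℝ) (k : ℕ) :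
    PowerSeries.coeff k (momentSeries a b)
      = (∑ j, a j * frozenTime b j ^ k) / (k.factorial : ℝ) := by
  simp [momentSeries, coeff_expScaled, Finset.sum_div, mul_div_assoc]

/-- A new last factor adds `a_m X` times the current `(0, 0)` entry to entry `(0, 1)`; that entry is
`exp` of the preceding `b`, that is, of the last frozen time. -/
theorem isWordRep_scheme {m : ℕ} (a b : Fin m → ℝ) :
    IsWordRep (List.ofFn fun j => expSeries (a j) (letter 0) * expSeries (b j) (letter 1)).prod
      !![expScaled (∑ j, b j), PowerSeries.X * momentSeries a b; 0, 1] := by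
  induction m with
  | zero =>
    have h : (!![expScaled (∑ j, b j), PowerSeries.X * momentSeries a b; 0, 1] :
        Matrix (Fin 2) (Fin 2) (PowerSeries ℝ)) = 1 := by
      simp [momentSeries, expScaled_zero, Matrix.one_fin_two]
    rw [h]
    simpa using IsWordRep.one
  | succ m ih =>
    rw [List.ofFn_succ', List.prod_concat]
    have h := (ih (fun i => a i.castSucc) fun i => b i.castSucc).mul
      ((isWordRep_expSeries_letter_zero (a (Fin.last m))).mul
        (isWordRep_expSeries_letter_one (b (Fin.last m))))
    convert h using 1
    rw [Fin.sum_univ_castSucc, expScaled_add]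
    ext1 i j
    fin_cases i <;> fin_cases j <;>
      simp [momentSeries, Fin.sum_univ_castSucc, frozenTime_castSucc, frozenTime_last,
        Matrix.mul_apply]
    ring

/-- Reduces the matrix logarithm to the scalar series `log u / (u - 1)` multiplying `v`. -/
theorem sub_one_pow_fin_two {R : Type*} [CommRing R] (u v : R) (r : ℕ) :
    ((!![u, v; 0, 1] : Matrix (Fin 2) (Fin 2) R) - 1) ^ (r + 1)
      = !![(u - 1) ^ (r + 1), (u - 1) ^ r * v; 0, 0] := by
  have h : (!![u, v; 0, 1] : Matrix (Fin 2) (Fin 2) R) - 1 = !![u - 1, v; 0, 0] := by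
    ext i j
    fin_cases i <;> fin_cases j <;> simp
  rw [h]
  induction r with
  | zero => simp
  | succ r ih =>
    rw [pow_succ', ih]
    ext i j
    fin_cases i <;> fin_cases j <;> simp [pow_succ']
    ring

theorem eTwo_eq_sum {m : ℕ} (a b : Fin m → ℝ) : eTwo a b = ∑ j, b j := by
  have h1 := (wordRep_apply (PowerSeries.coeff 1 (schemeLog a b))).2.2.2.2 1
  have h2 := (isWordRep_scheme a b).logSeries 1 0 0
  rw [schemeLog] at h1
  rw [eTwo, schemeLog]
  simp only [List.replicate_one] at h1
  rw [← h1, h2]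
  simp [PowerSeries.coeff_one, coeff_expScaled]

/-- The partial sums of the series `log (1 + Y) / Y`. -/
noncomputable def logQuotient (k : ℕ) (Y : PowerSeries ℝ) : PowerSeries ℝ :=
  ∑ r ∈ Finset.range (k + 1), PowerSeries.C ((-1 : ℝ) ^ r / ((r : ℝ) + 1)) * Y ^ r

theorem wordCoeff_schemeLog {m : ℕ} (a b : Fin m → ℝ) (k : ℕ) :
    wordCoeff (List.replicate k 1 ++ [0]) (PowerSeries.coeff (k + 1) (schemeLog a b))
      = PowerSeries.coeff k (logQuotient k (expScaled (∑ j, b j) - 1) * momentSeries a b) := by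
  have h : Finset.Icc 1 (k + 1) = Finset.Ico (0 + 1) (k + 1 + 1) := by
    ext i
    simp
  rw [← (wordRep_apply _).2.2.2.1 k, schemeLog, (isWordRep_scheme a b).logSeries,
    logQuotient, Finset.sum_mul, map_sum, Finset.range_eq_Ico, h, ← Finset.sum_Ico_add']
  refine Finset.sum_congr rfl fun r _ => ?_
  rw [sub_one_pow_fin_two]
  simp only [of_apply, cons_val', cons_val_zero, cons_val_one, cons_val_fin_one]
  -- The factor `X` stands for the single `L₁` and absorbs one degree.
  rw [mul_left_comm, PowerSeries.coeff_succ_X_mul, mul_assoc, PowerSeries.coeff_C_mul]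
  congr 2
  · ring
  · push_cast
    ring

/-! ### The Bernoulli series in the logarithm -/

/-- The series `(exp X - 1) / X`. -/
noncomputable def expQuotient : PowerSeries ℝ := PowerSeries.mk fun k => 1 / ((k + 1).factorial : ℝ)

theorem X_mul_expQuotient : PowerSeries.X * expQuotient = PowerSeries.exp ℝ - 1 := by
  ext k
  cases k with
  | zero => simp
  | succ k => simp [PowerSeries.coeff_succ_X_mul, expQuotient, PowerSeries.coeff_one]

theorem bernoulliPowerSeries_mul_expQuotient : bernoulliPowerSeries ℝ * expQuotient = 1 := by
  have h := bernoulliPowerSeries_mul_exp_sub_one ℝ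
  rw [← X_mul_expQuotient, mul_left_comm] at h
  exact mul_left_cancel₀ PowerSeries.X_ne_zero (h.trans (mul_one _).symm)

/-- With `Y = exp X - 1`, the product is the truncated series of `log (1 + Y)`. Its derivative is
`Y' ∑ (-Y) ^ r`, and `Y' = 1 - (-Y)` makes the geometric sum telescope. -/
theorem derivative_mul_logQuotient (k : ℕ) :
    PowerSeries.derivative ℝ
      ((PowerSeries.exp ℝ - 1) * logQuotient k (PowerSeries.exp ℝ - 1))
      = 1 - (-(PowerSeries.exp ℝ - 1)) ^ (k + 1) := by
  have hd : PowerSeries.derivative ℝ (PowerSeries.exp ℝ - 1) = 1 - -(PowerSeries.exp ℝ - 1) := by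
    rw [map_sub, PowerSeries.derivative_exp]
    simp
  rw [← mul_neg_geom_sum, ← hd, logQuotient, Finset.mul_sum, map_sum, Finset.mul_sum]
  refine Finset.sum_congr rfl fun r _ => ?_
  have hr : (r : ℝ) + 1 ≠ 0 := by positivity
  rw [mul_left_comm, ← pow_succ', ← PowerSeries.smul_eq_C_mul, Derivation.map_smul,
    Derivation.leibniz_pow, Nat.add_sub_cancel, PowerSeries.smul_eq_C_mul, nsmul_eq_mul,
    smul_eq_mul, neg_pow (PowerSeries.exp ℝ - 1)]
  have e : PowerSeries.C ((-1 : ℝ) ^ r / ((r : ℝ) + 1)) * ((r + 1 : ℕ) : PowerSeries ℝ)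
      = (-1) ^ r := by
    rw [← map_natCast (PowerSeries.C (R := ℝ)), ← map_mul]
    push_cast
    rw [div_mul_cancel₀ _ hr]
    simp
  rw [← mul_assoc, e]
  ring

/-- By the derivative just computed, the truncated `log (exp X)` agrees with `X` below degree `k +
2`. Cancelling `X` and multiplying by the inverse of `expQuotient` gives the claim. -/
theorem X_pow_dvd_logQuotient_sub (k : ℕ) :
    PowerSeries.X ^ (k + 1) ∣ logQuotient k (PowerSeries.exp ℝ - 1) - bernoulliPowerSeries ℝ := by
  have h1 : PowerSeries.X ^ (k + 2) ∣
      (PowerSeries.exp ℝ - 1) * logQuotient k (PowerSeries.exp ℝ - 1) - PowerSeries.X := by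
    rw [PowerSeries.X_pow_dvd_iff]
    intro j hj
    cases j with
    | zero => simp
    | succ j =>
      have hj0 : (j : ℝ) + 1 ≠ 0 := by positivity
      have hX : PowerSeries.X ^ (k + 1) ∣ (-(PowerSeries.exp ℝ - 1)) ^ (k + 1) :=
        pow_dvd_pow_of_dvd (dvd_neg.2 ⟨_, X_mul_expQuotient.symm⟩) _
      have h2 := congrArg (PowerSeries.coeff j) (derivative_mul_logQuotient k)
      rw [map_sub, PowerSeries.X_pow_dvd_iff.1 hX j (by omega), PowerSeries.coeff_derivative,
        sub_zero] at h2
      have h3 : PowerSeries.coeff (j + 1) (PowerSeries.X : PowerSeries ℝ) * ((j : ℝ) + 1)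
          = PowerSeries.coeff j (1 : PowerSeries ℝ) := by
        rw [PowerSeries.coeff_X, PowerSeries.coeff_one]
        cases j <;> simp
      rw [← h3] at h2
      rw [map_sub, mul_right_cancel₀ hj0 h2, sub_self]
  have h4 : (PowerSeries.exp ℝ - 1) * logQuotient k (PowerSeries.exp ℝ - 1) - PowerSeries.X
      = PowerSeries.X * (expQuotient *
        (logQuotient k (PowerSeries.exp ℝ - 1) - bernoulliPowerSeries ℝ)) := by
    rw [mul_sub, mul_comm expQuotient (bernoulliPowerSeries ℝ),
      bernoulliPowerSeries_mul_expQuotient, mul_sub, ← mul_assoc, X_mul_expQuotient, mul_one]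
  rw [h4, pow_succ'] at h1
  have h5 := (mul_dvd_mul_iff_left PowerSeries.X_ne_zero).1 h1
  have h6 := Dvd.dvd.mul_left h5 (bernoulliPowerSeries ℝ)
  rwa [← mul_assoc, bernoulliPowerSeries_mul_expQuotient, one_mul] at h6

/-- The generating function of the coefficients of `L₂ ^ k L₁` in the logarithm of a scheme whose
step sizes `b` sum up to `1`. -/
noncomputable def logMomentSeries {m : ℕ} (a b : Fin m → ℝ) : PowerSeries ℝ :=
  bernoulliPowerSeries ℝ * momentSeries a b

theorem wordCoeff_schemeLog_of_sum_eq_one {m : ℕ} {a b : Fin m → ℝ} (hb : ∑ j, b j = 1) (k : ℕ) :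
    wordCoeff (List.replicate k 1 ++ [0]) (PowerSeries.coeff (k + 1) (schemeLog a b))
      = PowerSeries.coeff k (logMomentSeries a b) := by
  have h1 : expScaled 1 = PowerSeries.exp ℝ := by simp [expScaled]
  rw [wordCoeff_schemeLog, hb, h1, logMomentSeries, ← sub_eq_zero, ← map_sub, ← sub_mul]
  exact PowerSeries.X_pow_dvd_iff.1 ((X_pow_dvd_logQuotient_sub k).mul_right _) k k.lt_succ_self

/-- The exact moments have generating function `expQuotient`, whose inverse is the Bernoulli series;
multiplication by a unit preserves divisibility by `X ^ p`. -/
theorem quadratureOrder_iff_X_pow_dvd {m : ℕ} {a b : Fin m → ℝ} (hb : ∑ j, b j = 1) (p : ℕ) :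
    QuadratureOrder a b p ↔ PowerSeries.X ^ p ∣ logMomentSeries a b - 1 := by
  have h1 : logMomentSeries a b - 1 = bernoulliPowerSeries ℝ * (momentSeries a b - expQuotient) := by
    rw [mul_sub, bernoulliPowerSeries_mul_expQuotient, logMomentSeries]
  have h2 : momentSeries a b - expQuotient = expQuotient * (logMomentSeries a b - 1) := by
    rw [h1, ← mul_assoc, mul_comm expQuotient, bernoulliPowerSeries_mul_expQuotient, one_mul]
  have h3 : PowerSeries.X ^ p ∣ logMomentSeries a b - 1 ↔
      PowerSeries.X ^ p ∣ momentSeries a b - expQuotient :=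
    ⟨fun h => h2 ▸ h.mul_left _, fun h => h1 ▸ h.mul_left _⟩
  rw [h3, PowerSeries.X_pow_dvd_iff, QuadratureOrder, and_iff_right hb]
  refine forall₂_congr fun k _ => ?_
  have hf : (k.factorial : ℝ) ≠ 0 := by positivity
  have hk : (k : ℝ) + 1 ≠ 0 := by positivity
  rw [map_sub, sub_eq_zero, coeff_momentSeries, expQuotient, PowerSeries.coeff_mk,
    Nat.factorial_succ, div_eq_iff hf]
  push_cast
  rw [one_div_mul_eq_div, div_mul_cancel_right₀ hf, one_div]

/-! ### Symmetric schemes -/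

theorem frozenTime_eq_sum_range {m : ℕ} (b : Fin m → ℝ) (j : Fin m) :
    frozenTime b j = ∑ i ∈ Finset.range j, if h : i < m then b ⟨i, h⟩ else 0 := by
  have h1 : ∑ i ∈ Finset.range m, (if i < (j : ℕ) then (if h : i < m then b ⟨i, h⟩ else 0) else 0)
      = frozenTime b j := by
    rw [frozenTime_eq_sum_ite, Finset.sum_range]
    refine Finset.sum_congr rfl fun i _ => ?_
    simp
  rw [← h1, ← Finset.sum_filter]
  refine Finset.sum_congr ?_ fun _ _ => rfl
  ext i
  simp only [Finset.mem_filter, Finset.mem_range]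
  have := j.2
  omega

theorem sum_eq_sum_range_dite {m : ℕ} (b : Fin m → ℝ) :
    ∑ j, b j = ∑ i ∈ Finset.range m, if h : i < m then b ⟨i, h⟩ else 0 := by
  rw [Finset.sum_range]
  exact Finset.sum_congr rfl fun i _ => by simp

theorem sum_range_add_sum_range_of_reflect {g : ℕ → ℝ} {M k : ℕ} (hk : k ≤ M)
    (hg : ∀ i < M, g i = g (M - 1 - i)) :
    ∑ i ∈ Finset.range (M - k), g i = ∑ i ∈ Finset.range M, g i - ∑ i ∈ Finset.range k, g i := by
  have h1 := Finset.sum_range_reflect g M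
  have h2 := Finset.sum_range_add_sum_Ico g hk
  have h3 : ∑ i ∈ Finset.Ico k M, g i = ∑ i ∈ Finset.range (M - k), g i := by
    rw [← Finset.sum_range_reflect g (M - k), Finset.sum_Ico_eq_sum_range]
    refine Finset.sum_congr rfl fun i hi => ?_
    rw [Finset.mem_range] at hi
    rw [hg (k + i) (by omega)]
    congr 1
    omega
  linarith

theorem IsClassA.frozenTime_reflect {m : ℕ} {a b : Fin m → ℝ} (h : IsClassA a b) {i j : Fin m}
    (hij : (i : ℕ) + j + 1 = m) : frozenTime b j = ∑ l, b l - frozenTime b i := by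
  obtain ⟨M, rfl⟩ : ∃ M, m = M + 1 := ⟨m - 1, by omega⟩
  rw [frozenTime_eq_sum_range, frozenTime_eq_sum_range, sum_eq_sum_range_dite,
    Finset.sum_range_succ, show (j : ℕ) = M - i by omega,
    sum_range_add_sum_range_of_reflect (M := M) (by omega)]
  · simp [h.2.1 (⟨M, M.lt_succ_self⟩ : Fin (M + 1)) rfl]
  · intro l hl
    rw [dif_pos (by omega), dif_pos (by omega)]
    exact h.2.2 _ _ (by simp only; omega)

theorem IsClassB.frozenTime_reflect {m : ℕ} {a b : Fin m → ℝ} (h : IsClassB a b) {i j : Fin m}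
    (hij : (i : ℕ) + j = m) : frozenTime b j = ∑ l, b l - frozenTime b i := by
  rw [frozenTime_eq_sum_range, frozenTime_eq_sum_range, sum_eq_sum_range_dite,
    show (j : ℕ) = m - i by omega, sum_range_add_sum_range_of_reflect (M := m) (by omega)]
  intro l hl
  rw [dif_pos (by omega), dif_pos (by omega)]
  exact h.2.2 _ _ (by simp only; omega)

/-- Reversal pairs each node with its mirror image. In class b) node `0` has no partner, but its
weight is zero. -/
theorem sum_mul_frozenTime_reflect {m : ℕ} {a b : Fin m → ℝ} (h : IsClassA a b ∨ IsClassB a b)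
    {R : Type*} [CommRing R] [Algebra ℝ R] (f : ℝ → R) :
    ∑ j, algebraMap ℝ R (a j) * f (∑ l, b l - frozenTime b j)
      = ∑ j, algebraMap ℝ R (a j) * f (frozenTime b j) := by
  rcases h with h | h
  · refine Fintype.sum_equiv Fin.revPerm _ _ fun j => ?_
    have hj : (j : ℕ) + (Fin.revPerm j : Fin m) + 1 = m := by
      simp only [Fin.revPerm_apply, Fin.val_rev]
      omega
    rw [h.frozenTime_reflect hj, h.1 _ _ hj]
  · cases m with
    | zero => simp
    | succ m =>
      have hr : ∀ {i j : Fin (m + 1)}, (i : ℕ) + j = m + 1 →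
          frozenTime b j = ∑ l, b l - frozenTime b i := h.frozenTime_reflect
      -- Protects the total of `b` when index `0` is split off the outer sums.
      generalize ∑ l, b l = σ at hr ⊢
      rw [Fin.sum_univ_succ, Fin.sum_univ_succ, h.1 0 rfl, map_zero, zero_mul, zero_mul]
      congr 1
      refine Fintype.sum_equiv Fin.revPerm _ _ fun j => ?_
      have hj : (j.succ : ℕ) + ((Fin.revPerm j : Fin m).succ : Fin (m + 1)) = m + 1 := by
        simp only [Fin.revPerm_apply, Fin.val_succ, Fin.val_rev]
        omega
      rw [hr hj, h.2.1 _ _ hj]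

theorem rescale_neg_one_expScaled (c : ℝ) :
    PowerSeries.evalNegHom (expScaled c) = expScaled (-c) := by
  rw [PowerSeries.evalNegHom, expScaled, expScaled, PowerSeries.rescale_rescale]
  congr 2
  ring

theorem evalNegHom_bernoulliPowerSeries :
    PowerSeries.evalNegHom (bernoulliPowerSeries ℝ)
      = bernoulliPowerSeries ℝ * PowerSeries.exp ℝ := by
  have h1 := bernoulliPowerSeries_mul_exp_sub_one ℝ
  have h2 := congrArg PowerSeries.evalNegHom h1
  rw [map_mul, map_sub, map_one, PowerSeries.evalNegHom_X] at h2
  have h3 := PowerSeries.exp_mul_exp_neg_eq_one (A := ℝ)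
  have hne : PowerSeries.exp ℝ - 1 ≠ 0 := by
    intro h0
    rw [h0, mul_zero] at h1
    exact PowerSeries.X_ne_zero h1.symm
  refine mul_right_cancel₀ hne ?_
  linear_combination (-PowerSeries.exp ℝ) * h2 + PowerSeries.exp ℝ * (-h1) +
    PowerSeries.evalNegHom (bernoulliPowerSeries ℝ) * h3

/-- Reflection of the nodes gives `exp X * M(-X) = M(X)`, and `B(-X) = B(X) * exp X`, so the
exponentials match up. -/
theorem evalNegHom_logMomentSeries {m : ℕ} {a b : Fin m → ℝ} (h : IsClassA a b ∨ IsClassB a b)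
    (hb : ∑ j, b j = 1) :
    PowerSeries.evalNegHom (logMomentSeries a b) = logMomentSeries a b := by
  have h1 : PowerSeries.exp ℝ * PowerSeries.evalNegHom (momentSeries a b) = momentSeries a b := by
    have h2 := sum_mul_frozenTime_reflect h expScaled
    rw [hb] at h2
    have he : PowerSeries.exp ℝ = expScaled 1 := by simp [expScaled]
    have hC : ∀ r : ℝ, PowerSeries.evalNegHom (PowerSeries.C r) = PowerSeries.C r := fun r => by
      ext k
      rw [PowerSeries.evalNegHom, PowerSeries.coeff_rescale, PowerSeries.coeff_C]
      split_ifs with hk <;> simp [hk]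
    rw [momentSeries, map_sum, Finset.mul_sum]
    refine Eq.trans (Finset.sum_congr rfl fun j _ => ?_) h2
    rw [map_mul, hC, rescale_neg_one_expScaled, mul_left_comm, he, ← expScaled_add,
      ← sub_eq_add_neg]
    rfl
  rw [logMomentSeries, map_mul, evalNegHom_bernoulliPowerSeries, mul_assoc, h1]

theorem coeff_logMomentSeries_of_odd {m : ℕ} {a b : Fin m → ℝ} (h : IsClassA a b ∨ IsClassB a b)
    (hb : ∑ j, b j = 1) {k : ℕ} (hk : Odd k) : PowerSeries.coeff k (logMomentSeries a b) = 0 := by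
  have h1 := congrArg (PowerSeries.coeff k) (evalNegHom_logMomentSeries h hb)
  rw [PowerSeries.evalNegHom, PowerSeries.coeff_rescale, hk.neg_one_pow] at h1
  linarith

theorem quadratureOrder_iff_eNested {m : ℕ} {a b : Fin m → ℝ} (h : IsClassA a b ∨ IsClassB a b)
    {q : ℕ} (hq : 1 ≤ q) : QuadratureOrder a b (2 * q) ↔ eOne a b = 1 ∧ eTwo a b = 1 ∧
      ∀ i : ℕ, 1 ≤ i → i < q → eNested a b (2 * i + 1) = 0 := by
  rw [eTwo_eq_sum]
  by_cases hb : ∑ j, b j = 1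
  · have hone : eOne a b = PowerSeries.coeff 0 (logMomentSeries a b) :=
      wordCoeff_schemeLog_of_sum_eq_one hb 0
    have hnest : ∀ i, eNested a b (2 * i + 1) = -PowerSeries.coeff (2 * i) (logMomentSeries a b) :=
      fun i => by rw [eNested, Nat.add_sub_cancel, wordCoeff_schemeLog_of_sum_eq_one hb]
    rw [quadratureOrder_iff_X_pow_dvd hb, PowerSeries.X_pow_dvd_iff, hone]
    simp only [hnest, neg_eq_zero, map_sub, sub_eq_zero, PowerSeries.coeff_one, hb, true_and]
    constructor
    · intro H
      refine ⟨by simpa using H 0 (by omega), fun i h1 h2 => ?_⟩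
      rw [H (2 * i) (by omega), if_neg (by omega)]
    · rintro ⟨H0, H⟩ k hk
      rcases Nat.even_or_odd' k with ⟨i, rfl | rfl⟩
      · rcases Nat.eq_zero_or_pos i with rfl | hi
        · simpa using H0
        · rw [H i hi (by omega), if_neg (by omega)]
      · rw [coeff_logMomentSeries_of_odd h hb ⟨i, rfl⟩, if_neg (by omega)]
  · exact iff_of_false (fun H => hb H.1) fun H => hb H.2.1

/-! ### Orthogonal polynomials and Gaussian quadrature on the unit interval -/

section Gauss

open Polynomial

/-- The integral of a polynomial over `[0, 1]`. -/
noncomputable def unitIntegral : ℝ[X] →ₗ[ℝ] ℝ where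
  toFun P := ∫ x in (0 : ℝ)..1, P.eval x
  map_add' P Q := by
    simp only [eval_add]
    exact intervalIntegral.integral_add (P.continuous.intervalIntegrable _ _)
      (Q.continuous.intervalIntegrable _ _)
  map_smul' r P := by simp

theorem unitIntegral_apply (P : ℝ[X]) : unitIntegral P = ∫ x in (0 : ℝ)..1, P.eval x := rfl

theorem unitIntegral_X_pow (k : ℕ) : unitIntegral (X ^ k) = 1 / ((k : ℝ) + 1) := by
  simp [unitIntegral_apply]

theorem unitIntegral_comp_one_sub_X (P : ℝ[X]) : unitIntegral (P.comp (1 - X)) = unitIntegral P := by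
  have h := intervalIntegral.integral_comp_sub_left (a := 0) (b := 1) (fun x => P.eval x) 1
  simpa [unitIntegral_apply] using h

theorem unitIntegral_nonneg {P : ℝ[X]} (h : ∀ x ∈ Icc (0 : ℝ) 1, 0 ≤ P.eval x) :
    0 ≤ unitIntegral P :=
  intervalIntegral.integral_nonneg zero_le_one h

theorem unitIntegral_pos {P : ℝ[X]} (hP : P ≠ 0) (h : ∀ x ∈ Icc (0 : ℝ) 1, 0 ≤ P.eval x) :
    0 < unitIntegral P := by
  refine intervalIntegral.integral_pos zero_lt_one P.continuousOn
    (fun x hx => h x (Ioc_subset_Icc_self hx)) ?_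
  by_contra! hc
  refine hP (eq_zero_of_infinite_isRoot P ((Icc_infinite zero_lt_one).mono fun x hx => ?_))
  exact le_antisymm (hc x hx) (h x hx)

theorem unitIntegral_eq_sum {P : ℝ[X]} {p : ℕ} (h : P.natDegree < p) :
    unitIntegral P = ∑ k ∈ Finset.range p, P.coeff k * (1 / ((k : ℝ) + 1)) := by
  conv_lhs => rw [P.as_sum_range' p h]
  rw [map_sum]
  refine Finset.sum_congr rfl fun k _ => ?_
  rw [← smul_X_eq_monomial, map_smul, unitIntegral_X_pow, smul_eq_mul]

/-- The monic polynomial with simple roots at the nodes `s`. -/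
noncomputable def nodePoly (s : Finset ℝ) : ℝ[X] := ∏ r ∈ s, (X - C r)

theorem nodePoly_monic (s : Finset ℝ) : (nodePoly s).Monic :=
  monic_prod_of_monic _ _ fun r _ => monic_X_sub_C r

theorem natDegree_nodePoly (s : Finset ℝ) : (nodePoly s).natDegree = s.card := by
  simp [nodePoly]

theorem eval_nodePoly_eq_zero_iff {s : Finset ℝ} {x : ℝ} : (nodePoly s).eval x = 0 ↔ x ∈ s := by
  simp [nodePoly, eval_prod, Finset.prod_eq_zero_iff, sub_eq_zero]

/-- The set `s` collects the roots in `(0, 1)` of odd multiplicity: meeting a root again removes it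
from `s` and moves the pair into `G ^ 2`. -/
theorem exists_eq_sq_mul_nodePoly_mul (P : ℝ[X]) (hP : P ≠ 0) : ∃ (G Q : ℝ[X]) (s : Finset ℝ),
    (s : Set ℝ) ⊆ Ioo 0 1 ∧ P = G ^ 2 * nodePoly s * Q ∧ ∀ x ∈ Ioo (0 : ℝ) 1, Q.eval x ≠ 0 := by
  induction hd : P.natDegree using Nat.strong_induction_on generalizing P with
  | _ d ih =>
    by_cases hr : ∃ x ∈ Ioo (0 : ℝ) 1, P.eval x = 0
    · obtain ⟨x, hx, hx0⟩ := hr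
      obtain ⟨P', rfl⟩ := dvd_iff_isRoot.2 hx0
      have hP' : P' ≠ 0 := right_ne_zero_of_mul hP
      obtain ⟨G, Q, s, hs, he, hQ⟩ := ih P'.natDegree (by
        rw [← hd, natDegree_mul (X_sub_C_ne_zero x) hP', natDegree_X_sub_C]
        omega) P' hP' rfl
      by_cases hxs : x ∈ s
      · refine ⟨G * (X - C x), Q, s.erase x, fun y hy => hs (Finset.mem_of_mem_erase hy), ?_, hQ⟩
        have h1 : (X - C x) * nodePoly (s.erase x) = nodePoly s :=
          Finset.mul_prod_erase s (fun r => X - C r) hxs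
        rw [he, ← h1]
        ring
      · refine ⟨G, Q, insert x s, ?_, ?_, hQ⟩
        · rw [Finset.coe_insert]
          exact insert_subset hx hs
        · rw [he, nodePoly, nodePoly, Finset.prod_insert hxs]
          ring
    · push Not at hr
      exact ⟨1, P, ∅, by simp, by simp [nodePoly], hr⟩

theorem eval_nonneg_or_nonpos_of_ne_zero {Q : ℝ[X]} (hQ : ∀ x ∈ Ioo (0 : ℝ) 1, Q.eval x ≠ 0) :
    (∀ x ∈ Icc (0 : ℝ) 1, 0 ≤ Q.eval x) ∨ ∀ x ∈ Icc (0 : ℝ) 1, Q.eval x ≤ 0 := by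
  have hcl : closure (Ioo (0 : ℝ) 1) = Icc 0 1 := closure_Ioo zero_ne_one
  have key : (∀ x ∈ Ioo (0 : ℝ) 1, 0 ≤ Q.eval x) ∨ ∀ x ∈ Ioo (0 : ℝ) 1, Q.eval x ≤ 0 := by
    by_contra! hc
    obtain ⟨⟨x, hx, hx0⟩, y, hy, hy0⟩ := hc
    obtain ⟨z, hz, hz0⟩ := isPreconnected_Ioo.intermediate_value hx hy Q.continuousOn
      ⟨hx0.le, hy0.le⟩
    exact hQ z hz hz0
  refine key.imp (fun h x hx => ?_) fun h x hx => ?_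
  · rw [← hcl] at hx
    exact closure_minimal (s := Ioo (0 : ℝ) 1) (t := {x | 0 ≤ Q.eval x}) h
      (isClosed_le continuous_const Q.continuous) hx
  · rw [← hcl] at hx
    exact closure_minimal (s := Ioo (0 : ℝ) 1) (t := {x | Q.eval x ≤ 0}) h
      (isClosed_le Q.continuous continuous_const) hx

/-- Dimension count: `q` linear conditions on a space of dimension `q + 1`. -/
theorem exists_orthogonal (w : ℝ[X]) (q : ℕ) : ∃ P : ℝ[X], P ≠ 0 ∧ P.natDegree ≤ q ∧
    ∀ g : ℝ[X], g.degree < q → unitIntegral (w * P * g) = 0 := by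
  let φ : degreeLT ℝ (q + 1) →ₗ[ℝ] (Fin q → ℝ) := LinearMap.pi fun k =>
    unitIntegral ∘ₗ LinearMap.mulRight ℝ (X ^ (k : ℕ)) ∘ₗ LinearMap.mulLeft ℝ w ∘ₗ
      (degreeLT ℝ (q + 1)).subtype
  let e := degreeLTEquiv ℝ (q + 1)
  have hφ : LinearMap.ker (φ ∘ₗ e.symm.toLinearMap) ≠ ⊥ :=
    LinearMap.ker_ne_bot_of_finrank_lt (by simp)
  obtain ⟨x, hx, hx0⟩ := (Submodule.ne_bot_iff _).1 hφ
  set P := e.symm x with hP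
  have hP0 : (P : ℝ[X]) ≠ 0 := by
    intro h
    exact hx0 (e.symm.map_eq_zero_iff.1 (Subtype.ext h))
  refine ⟨P, hP0, ?_, fun g hg => ?_⟩
  · have h := mem_degreeLT.1 P.2
    exact Nat.lt_succ_iff.1 ((natDegree_lt_iff_degree_lt hP0).2 h)
  · have hk : ∀ k < q, unitIntegral (w * (P : ℝ[X]) * X ^ k) = 0 := fun k hk =>
      congrFun (LinearMap.mem_ker.1 hx) ⟨k, hk⟩
    rcases eq_or_ne g 0 with rfl | hg0
    · simp
    · rw [g.as_sum_range' q ((natDegree_lt_iff_degree_lt hg0).2 hg), Finset.mul_sum, map_sum]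
      refine Finset.sum_eq_zero fun k hkq => ?_
      rw [← smul_X_eq_monomial, mul_smul_comm, map_smul, hk k (Finset.mem_range.1 hkq), smul_zero]

/-- With fewer than `q` sign changes, multiplying the orthogonal polynomial by `nodePoly` of their
locations would give constant sign and a nonzero integral. So there are `q` simple roots in `(0,
1)`, which exhaust the degree. -/
theorem exists_orthogonal_nodePoly {w : ℝ[X]} (hw0 : w ≠ 0)
    (hw : ∀ x ∈ Icc (0 : ℝ) 1, 0 ≤ w.eval x) (q : ℕ) : ∃ s : Finset ℝ,
      s.card = q ∧ (s : Set ℝ) ⊆ Ioo 0 1 ∧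
        ∀ g : ℝ[X], g.degree < q → unitIntegral (w * nodePoly s * g) = 0 := by
  obtain ⟨P, hP0, hPd, hP⟩ := exists_orthogonal w q
  obtain ⟨G, Q, s, hs, he, hQ⟩ := exists_eq_sq_mul_nodePoly_mul P hP0
  have hQ0 : Q ≠ 0 := right_ne_zero_of_mul (he ▸ hP0)
  have hG0 : G ≠ 0 := by
    rintro rfl
    exact hP0 (by rw [he]; ring)
  have hN0 : nodePoly s ≠ 0 := (nodePoly_monic s).ne_zero
  have hdeg : P.natDegree = 2 * G.natDegree + s.card + Q.natDegree := by
    rw [he, natDegree_mul (mul_ne_zero (pow_ne_zero 2 hG0) hN0) hQ0,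
      natDegree_mul (pow_ne_zero 2 hG0) hN0, natDegree_pow, natDegree_nodePoly]
  have hcard : q ≤ s.card := by
    by_contra! hlt
    have h0 := hP (nodePoly s) (by
      rw [degree_eq_natDegree hN0, natDegree_nodePoly]
      exact_mod_cast hlt)
    have hne : w * (G * nodePoly s) ^ 2 * Q ≠ 0 :=
      mul_ne_zero (mul_ne_zero hw0 (pow_ne_zero 2 (mul_ne_zero hG0 hN0))) hQ0
    have e1 : w * P * nodePoly s = w * (G * nodePoly s) ^ 2 * Q := by
      rw [he]
      ring
    rw [e1] at h0
    have hnn : ∀ x ∈ Icc (0 : ℝ) 1, 0 ≤ w.eval x * ((G * nodePoly s).eval x) ^ 2 := fun x hx =>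
      mul_nonneg (hw x hx) (sq_nonneg _)
    rcases eval_nonneg_or_nonpos_of_ne_zero hQ with h | h
    · refine (unitIntegral_pos hne fun x hx => ?_).ne' h0
      rw [eval_mul, eval_mul, eval_pow]
      exact mul_nonneg (hnn x hx) (h x hx)
    · refine (unitIntegral_pos (neg_ne_zero.2 hne) fun x hx => ?_).ne' (by rw [map_neg, h0, neg_zero])
      rw [eval_neg, eval_mul, eval_mul, eval_pow]
      exact neg_nonneg.2 (mul_nonpos_of_nonneg_of_nonpos (hnn x hx) (h x hx))
  have hG : G.natDegree = 0 := by omega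
  have hQd : Q.natDegree = 0 := by omega
  obtain ⟨c, rfl⟩ := natDegree_eq_zero.1 hG
  obtain ⟨d, rfl⟩ := natDegree_eq_zero.1 hQd
  have hcd : c ^ 2 * d ≠ 0 := mul_ne_zero (pow_ne_zero 2 (C_ne_zero.1 hG0)) (C_ne_zero.1 hQ0)
  refine ⟨s, by omega, hs, fun g hg => ?_⟩
  have h1 := hP g hg
  have e1 : w * P * g = (c ^ 2 * d) • (w * nodePoly s * g) := by
    rw [he, smul_eq_C_mul, C_mul, C_pow]
    ring
  rw [e1, map_smul, smul_eq_mul] at h1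
  exact (mul_eq_zero.1 h1).resolve_left hcd

/-- For a symmetric weight the reflected polynomial is orthogonal too. Subtracting the multiple of
`nodePoly s` with equal leading term leaves `D` of lower degree with `∫ w D ^ 2 = 0`, hence `D = 0`.
-/
theorem one_sub_mem_of_orthogonal {w : ℝ[X]} (hw0 : w ≠ 0)
    (hw : ∀ x ∈ Icc (0 : ℝ) 1, 0 ≤ w.eval x) (hws : w.comp (1 - X) = w) {s : Finset ℝ}
    (hs : ∀ g : ℝ[X], g.degree < s.card → unitIntegral (w * nodePoly s * g) = 0) {r : ℝ}
    (hr : r ∈ s) : 1 - r ∈ s := by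
  have hl : (1 - X : ℝ[X]) = -(X - C 1) := by simp
  have hd1 : (1 - X : ℝ[X]).natDegree = 1 := by rw [hl, natDegree_neg, natDegree_X_sub_C]
  have hlc : (1 - X : ℝ[X]).leadingCoeff = -1 := by
    rw [hl, leadingCoeff_neg, leadingCoeff_X_sub_C]
  have hcomp : ∀ P : ℝ[X], (P.comp (1 - X)).comp (1 - X) = P := fun P => by
    rw [comp_assoc]
    simp
  set N := nodePoly s with hN
  set N' := N.comp (1 - X) with hN'
  set ε : ℝ := (-1) ^ s.card with hε
  have hε0 : ε ≠ 0 := pow_ne_zero _ (by norm_num)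
  have hN0 : N ≠ 0 := (nodePoly_monic s).ne_zero
  have hlcN' : N'.leadingCoeff = ε := by
    rw [hN', leadingCoeff_comp (by rw [hd1]; exact one_ne_zero), hlc,
      (nodePoly_monic s).leadingCoeff, natDegree_nodePoly, one_mul]
  have hN'0 : N' ≠ 0 := by
    intro h
    rw [h, leadingCoeff_zero] at hlcN'
    exact hε0 hlcN'.symm
  have hdN' : N'.natDegree = s.card := by
    rw [hN', natDegree_comp, hd1, mul_one, natDegree_nodePoly]
  set D := N' - C ε * N with hD
  have hDd : D.degree < s.card := by
    rw [← hdN', ← degree_eq_natDegree hN'0]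
    refine degree_sub_lt_left ?_ hN'0 ?_
    · rw [degree_C_mul hε0, degree_eq_natDegree hN'0, degree_eq_natDegree hN0, hdN',
        natDegree_nodePoly]
    · rw [hlcN', leadingCoeff_mul, leadingCoeff_C, (nodePoly_monic s).leadingCoeff, mul_one]
  have h1 : unitIntegral (w * N' * D) = 0 := by
    rw [← unitIntegral_comp_one_sub_X, mul_comp, mul_comp, hws, hN', hcomp]
    refine hs _ ?_
    rcases eq_or_ne (D.comp (1 - X)) 0 with h | h
    · rw [h, degree_zero]
      exact WithBot.bot_lt_coe _
    · rw [← natDegree_lt_iff_degree_lt h, natDegree_comp, hd1, mul_one]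
      refine (natDegree_lt_iff_degree_lt ?_).2 hDd
      rintro h'
      exact h (by rw [h', zero_comp])
  have h2 : unitIntegral (w * D ^ 2) = 0 := by
    have e : w * D ^ 2 = w * N' * D - ε • (w * N * D) := by
      rw [smul_eq_C_mul, hD]
      ring
    rw [e, map_sub, map_smul, h1, hs D hDd, smul_zero, sub_zero]
  have h3 : D = 0 := by
    by_contra hD0
    refine (unitIntegral_pos (mul_ne_zero hw0 (pow_ne_zero 2 hD0)) fun x hx => ?_).ne' h2
    rw [eval_mul, eval_pow]
    exact mul_nonneg (hw x hx) (sq_nonneg _)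
  have h4 : N'.eval (1 - r) = 0 := by
    rw [hN', eval_comp]
    simpa using eval_nodePoly_eq_zero_iff.2 hr
  rw [sub_eq_zero.1 h3, eval_mul, eval_C] at h4
  exact eval_nodePoly_eq_zero_iff.1 ((mul_eq_zero.1 h4).resolve_left hε0)

/-! ### Interpolatory quadrature formulas -/

/-- The weights of the interpolatory quadrature formula with nodes `S`. -/
noncomputable def interpolatoryWeight (S : Finset ℝ) (r : ℝ) : ℝ :=
  unitIntegral (Lagrange.basis S id r)

/-- Gauss's argument: divide by `nodePoly S`. The quotient part integrates to zero by orthogonality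
and vanishes at the nodes; the remainder equals its interpolant. -/
theorem sum_interpolatoryWeight_mul_eval {S : Finset ℝ} {d : ℕ}
    (hS : ∀ g : ℝ[X], g.degree < d → unitIntegral (nodePoly S * g) = 0) {f : ℝ[X]}
    (hf : f.natDegree < S.card + d) :
    ∑ r ∈ S, interpolatoryWeight S r * f.eval r = unitIntegral f := by
  have hm := nodePoly_monic S
  have hsplit := modByMonic_add_div f (nodePoly S)
  have hrem : unitIntegral f = unitIntegral (f %ₘ nodePoly S) := by
    have h0 : unitIntegral (nodePoly S * (f /ₘ nodePoly S)) = 0 := by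
      refine hS _ ?_
      rcases eq_or_ne (f /ₘ nodePoly S) 0 with h | h
      · rw [h, degree_zero]
        exact WithBot.bot_lt_coe _
      · have hc : S.card ≤ f.natDegree := by
          by_contra! hlt
          refine h ((divByMonic_eq_zero_iff hm).2 (degree_lt_degree ?_))
          rwa [natDegree_nodePoly]
        rw [← natDegree_lt_iff_degree_lt h, natDegree_divByMonic f hm, natDegree_nodePoly]
        omega
    conv_lhs => rw [← hsplit]
    rw [map_add, h0, add_zero]
  have hint : f %ₘ nodePoly S
      = Lagrange.interpolate S id (fun r => (f %ₘ nodePoly S).eval r) := by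
    refine Lagrange.eq_interpolate (injOn_id _) ?_
    refine (degree_modByMonic_lt f hm).trans_le ?_
    rw [degree_eq_natDegree hm.ne_zero, natDegree_nodePoly]
  rw [hrem, hint, Lagrange.interpolate_apply, map_sum]
  refine Finset.sum_congr rfl fun r hr => ?_
  rw [← smul_eq_C_mul, map_smul, smul_eq_mul, mul_comm, interpolatoryWeight]
  congr 1
  conv_lhs => rw [← hsplit]
  rw [eval_add, eval_mul, eval_nodePoly_eq_zero_iff.2 hr, zero_mul, add_zero]

theorem interpolatoryWeight_nonneg {S : Finset ℝ} {d : ℕ}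
    (hS : ∀ g : ℝ[X], g.degree < d → unitIntegral (nodePoly S * g) = 0) {r : ℝ} (hr : r ∈ S)
    (f : ℝ[X]) (hf : f.natDegree < S.card + d) (hf0 : ∀ x ∈ Icc (0 : ℝ) 1, 0 ≤ f.eval x)
    (hfr : 0 < f.eval r) (hfs : ∀ x ∈ S, x ≠ r → f.eval x = 0) : 0 ≤ interpolatoryWeight S r := by
  have h1 := sum_interpolatoryWeight_mul_eval hS hf
  rw [Finset.sum_eq_single_of_mem r hr fun x hx hxr => by rw [hfs x hx hxr, mul_zero]] at h1
  exact nonneg_of_mul_nonneg_left (h1 ▸ unitIntegral_nonneg hf0) hfr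

/-- A symmetric quadrature formula on `[0, 1]` with nodes `S` and nonnegative weights `ω`. -/
structure IsSymmetricQuadrature (S : Finset ℝ) (ω : ℝ → ℝ) (p : ℕ) : Prop where
  subset : (S : Set ℝ) ⊆ Icc 0 1
  one_sub_mem : ∀ r ∈ S, 1 - r ∈ S
  nonneg : ∀ r ∈ S, 0 ≤ ω r
  weight_one_sub : ∀ r ∈ S, ω (1 - r) = ω r
  moment : ∀ k < p, ∑ r ∈ S, ω r * r ^ k = 1 / ((k : ℝ) + 1)

theorem exists_isSymmetricQuadrature {S : Finset ℝ} {d : ℕ} (hsub : (S : Set ℝ) ⊆ Icc 0 1)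
    (hsymm : ∀ r ∈ S, 1 - r ∈ S)
    (hS : ∀ g : ℝ[X], g.degree < d → unitIntegral (nodePoly S * g) = 0)
    (hpos : ∀ r ∈ S, 0 ≤ interpolatoryWeight S r) :
    ∃ ω, IsSymmetricQuadrature S ω (S.card + d) := by
  -- Averaging with the reflected weights makes symmetry immediate; exactness survives because `(1 -
  -- x) ^ k` is integrated exactly as well.
  refine ⟨fun r => (interpolatoryWeight S r + interpolatoryWeight S (1 - r)) / 2, hsub, hsymm,
    fun r hr => ?_, fun r _ => ?_, fun k hk => ?_⟩
  · have := hpos r hr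
    have := hpos _ (hsymm r hr)
    positivity
  · rw [sub_sub_cancel, add_comm]
  · have h1 := sum_interpolatoryWeight_mul_eval hS (f := X ^ k) (by simpa using hk)
    have h2 := sum_interpolatoryWeight_mul_eval hS (f := (X ^ k : ℝ[X]).comp (1 - X)) (by
      have hl : (1 - X : ℝ[X]) = -(X - C 1) := by simp
      rw [natDegree_comp, hl, natDegree_neg, natDegree_X_sub_C]
      simpa using hk)
    rw [unitIntegral_comp_one_sub_X] at h2
    have h3 : ∑ r ∈ S, interpolatoryWeight S (1 - r) * r ^ k
        = ∑ r ∈ S, interpolatoryWeight S r * ((X ^ k : ℝ[X]).comp (1 - X)).eval r := by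
      refine Finset.sum_nbij' (fun r => 1 - r) (fun r => 1 - r) hsymm hsymm
        (fun r _ => sub_sub_cancel 1 r) (fun r _ => sub_sub_cancel 1 r) fun r _ => ?_
      simp
    rw [unitIntegral_X_pow] at h1 h2
    simp only [eval_pow, eval_X] at h1
    have e : ∀ r, (interpolatoryWeight S r + interpolatoryWeight S (1 - r)) / 2 * r ^ k
        = (interpolatoryWeight S r * r ^ k + interpolatoryWeight S (1 - r) * r ^ k) / 2 :=
      fun r => by ring
    simp only [e]
    rw [← Finset.sum_div, Finset.sum_add_distrib, h1, h3, h2]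
    ring

end Gauss

/-! ### Gauss and Lobatto formulas -/

section Schemes

open Polynomial

theorem exists_gauss_quadrature (q : ℕ) : ∃ (S : Finset ℝ) (ω : ℝ → ℝ), S.card = q ∧
    (S : Set ℝ) ⊆ Ioo 0 1 ∧ IsSymmetricQuadrature S ω (2 * q) := by
  obtain ⟨s, hc, hs, hN⟩ := exists_orthogonal_nodePoly (w := 1) one_ne_zero (by simp) q
  have hN1 : ∀ g : ℝ[X], g.degree < q → unitIntegral (nodePoly s * g) = 0 := by simpa using hN
  have hsymm : ∀ r ∈ s, 1 - r ∈ s := fun r hr =>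
    one_sub_mem_of_orthogonal one_ne_zero (by simp) (by simp) (by rwa [hc]) hr
  obtain ⟨ω, hω⟩ := exists_isSymmetricQuadrature (hs.trans Ioo_subset_Icc_self) hsymm hN1
    fun r hr => by
      refine interpolatoryWeight_nonneg hN1 hr (nodePoly (s.erase r) ^ 2) ?_ ?_ ?_ ?_
      · rw [natDegree_pow, natDegree_nodePoly, Finset.card_erase_of_mem hr]
        have := Finset.card_pos.2 ⟨r, hr⟩
        omega
      · intro x _
        rw [eval_pow]
        exact sq_nonneg _
      · rw [eval_pow]
        refine sq_pos_of_ne_zero fun h => ?_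
        exact Finset.notMem_erase r s (eval_nodePoly_eq_zero_iff.1 h)
      · intro x hx hxr
        rw [eval_pow, eval_nodePoly_eq_zero_iff.2 (Finset.mem_erase.2 ⟨hxr, hx⟩), zero_pow two_ne_zero]
  refine ⟨s, ω, hc, hs, ?_⟩
  rwa [hc, ← two_mul] at hω

/-- The interior nodes are orthogonal for the weight `X (1 - X)`, the factor contributed by the
endpoints up to sign. The test polynomials for nonnegative weights square only interior factors. -/
theorem exists_lobatto_quadrature (q : ℕ) : ∃ (S : Finset ℝ) (ω : ℝ → ℝ), S.card = q + 2 ∧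
    0 ∈ S ∧ IsSymmetricQuadrature S ω (2 * (q + 1)) := by
  have hw0 : (X * (1 - X) : ℝ[X]) ≠ 0 := by
    intro h
    have := congrArg (eval (2 : ℝ)) h
    norm_num at this
  have hw : ∀ x ∈ Icc (0 : ℝ) 1, 0 ≤ (X * (1 - X) : ℝ[X]).eval x := fun x hx => by
    simpa using mul_nonneg hx.1 (sub_nonneg.2 hx.2)
  obtain ⟨s, hc, hs, hN⟩ := exists_orthogonal_nodePoly hw0 hw q
  have h0 : (0 : ℝ) ∉ s := fun h => lt_irrefl _ (hs h).1
  have h1 : (1 : ℝ) ∉ s := fun h => lt_irrefl _ (hs h).2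
  have h01 : (0 : ℝ) ∉ insert 1 s := by simp [h0]
  set S : Finset ℝ := insert 0 (insert 1 s) with hS
  have hcard : S.card = q + 2 := by
    rw [hS, Finset.card_insert_of_notMem h01, Finset.card_insert_of_notMem h1, hc]
  have hmem : ∀ {r}, r ∈ S ↔ r = 0 ∨ r = 1 ∨ r ∈ s := fun {r} => by simp [hS]
  have hN1 : ∀ g : ℝ[X], g.degree < q → unitIntegral (nodePoly S * g) = 0 := by
    intro g hg
    have e : nodePoly S * g = -(X * (1 - X) * nodePoly s * g) := by
      rw [nodePoly, hS, Finset.prod_insert h01, Finset.prod_insert h1, nodePoly, C_0, C_1]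
      ring
    rw [e, map_neg, hN g hg, neg_zero]
  have hsub : (S : Set ℝ) ⊆ Icc 0 1 := by
    intro r hr
    rcases hmem.1 hr with rfl | rfl | h
    · simp
    · simp
    · exact Ioo_subset_Icc_self (hs h)
  have hsymm : ∀ r ∈ S, 1 - r ∈ S := by
    intro r hr
    rcases hmem.1 hr with rfl | rfl | h
    · simp [hS]
    · simp [hS]
    · exact hmem.2 (.inr (.inr (one_sub_mem_of_orthogonal hw0 hw (by
        simp only [mul_comp, sub_comp, X_comp, one_comp]
        ring) (by rwa [hc]) h)))
  have hsq : ∀ (T : Finset ℝ) (r : ℝ), r ∉ T → 0 < (nodePoly T).eval r ^ 2 := fun T r hr =>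
    sq_pos_of_ne_zero fun h => hr (eval_nodePoly_eq_zero_iff.1 h)
  have hl : (1 - X : ℝ[X]) = -(X - C 1) := by simp
  have hd : (1 - X : ℝ[X]).natDegree = 1 := by rw [hl, natDegree_neg, natDegree_X_sub_C]
  obtain ⟨ω, hω⟩ := exists_isSymmetricQuadrature hsub hsymm hN1 fun r hr => by
    rcases hmem.1 hr with rfl | rfl | h
    · refine interpolatoryWeight_nonneg hN1 hr ((1 - X) * nodePoly s ^ 2) ?_ ?_ ?_ ?_
      · refine natDegree_mul_le.trans_lt ?_
        rw [natDegree_pow, natDegree_nodePoly, hd, hcard]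
        omega
      · intro x hx
        rw [eval_mul, eval_pow]
        exact mul_nonneg (by simpa using hx.2) (sq_nonneg _)
      · rw [eval_mul, eval_pow]
        exact mul_pos (by simp) (hsq s 0 h0)
      · intro x hx hx0
        rcases hmem.1 hx with rfl | rfl | h
        · exact absurd rfl hx0
        · simp
        · rw [eval_mul, eval_pow, eval_nodePoly_eq_zero_iff.2 h]
          ring
    · refine interpolatoryWeight_nonneg hN1 hr (X * nodePoly s ^ 2) ?_ ?_ ?_ ?_
      · refine natDegree_mul_le.trans_lt ?_
        rw [natDegree_pow, natDegree_nodePoly, natDegree_X, hcard]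
        omega
      · intro x hx
        rw [eval_mul, eval_pow, eval_X]
        exact mul_nonneg hx.1 (sq_nonneg _)
      · rw [eval_mul, eval_pow]
        exact mul_pos (by simp) (hsq s 1 h1)
      · intro x hx hx0
        rcases hmem.1 hx with rfl | rfl | h
        · simp
        · exact absurd rfl hx0
        · rw [eval_mul, eval_pow, eval_nodePoly_eq_zero_iff.2 h]
          ring
    · refine interpolatoryWeight_nonneg hN1 hr (X * (1 - X) * nodePoly (s.erase r) ^ 2) ?_ ?_ ?_ ?_
      · have := Finset.card_pos.2 ⟨r, h⟩
        have h2 : (X * (1 - X) : ℝ[X]).natDegree ≤ 1 + 1 :=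
          natDegree_mul_le.trans (by rw [hd, natDegree_X])
        refine natDegree_mul_le.trans_lt ?_
        rw [natDegree_pow, natDegree_nodePoly, hcard, Finset.card_erase_of_mem h]
        omega
      · intro x hx
        rw [eval_mul, eval_pow]
        exact mul_nonneg (hw x hx) (sq_nonneg _)
      · rw [eval_mul, eval_pow]
        refine mul_pos ?_ (hsq _ r (Finset.notMem_erase r s))
        simpa using mul_pos (hs h).1 (sub_pos.2 (hs h).2)
      · intro x hx hxr
        rcases hmem.1 hx with rfl | rfl | h'
        · simp
        · simp
        · rw [eval_mul, eval_pow, eval_nodePoly_eq_zero_iff.2 (Finset.mem_erase.2 ⟨hxr, h'⟩)]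
          ring
  refine ⟨S, ω, hcard, by simp [hS], ?_⟩
  rwa [hcard, show q + 2 + q = 2 * (q + 1) by ring] at hω

/-! ### Schemes from quadrature formulas -/

theorem exists_sorted_nodes {S : Finset ℝ} {M : ℕ} (hc : S.card = M + 1) (h0 : 0 ∈ S)
    (hS : (S : Set ℝ) ⊆ Icc 0 1) (hsymm : ∀ r ∈ S, 1 - r ∈ S) : ∃ c : ℕ → ℝ, c 0 = 0 ∧
      (∀ i, M ≤ i → c i = 1) ∧ (∀ i, c i ≤ c (i + 1)) ∧ (∀ i ≤ M, c (M - i) = 1 - c i) ∧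
      (∀ i ≤ M, c i ∈ S) ∧
      ∀ f : ℝ → ℝ, ∑ i ∈ Finset.range (M + 1), f (c i) = ∑ r ∈ S, f r := by
  set e := S.orderEmbOfFin hc with he
  -- Reflecting and reversing the increasing enumeration of `S` is again one, and it is unique.
  have hrev : (fun i : Fin (M + 1) => 1 - e (Fin.rev i)) = e :=
    Finset.orderEmbOfFin_unique hc (fun i => hsymm _ (Finset.orderEmbOfFin_mem S hc _))
      fun i j hij => sub_lt_sub_left (e.strictMono (Fin.rev_lt_rev.2 hij)) 1
  have hmem : ∀ i, e i ∈ S := fun i => Finset.orderEmbOfFin_mem S hc i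
  have he0 : e 0 = 0 := by
    have hr : (0 : ℝ) ∈ Set.range e := by
      rw [he, Finset.range_orderEmbOfFin]
      exact h0
    obtain ⟨i, hi⟩ := hr
    exact le_antisymm (hi ▸ e.monotone (Fin.zero_le i)) (hS (hmem 0)).1
  have hrev' : ∀ i, e (Fin.rev i) = 1 - e i := fun i => by
    have : 1 - e (Fin.rev i) = e i := congrFun hrev i
    linarith
  have he1 : e (Fin.last M) = 1 := by
    have := hrev' 0
    rwa [he0, sub_zero, Fin.rev_zero] at this
  -- The default `1` makes the increment after the last node vanish, which yields `b_m = 0` in class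
  -- a).
  set c : ℕ → ℝ := fun i => if h : i < M + 1 then e ⟨i, h⟩ else 1 with hcdef
  have hcl : ∀ i (h : i < M + 1), c i = e ⟨i, h⟩ := fun i h => dif_pos h
  have hcM : ∀ i, M ≤ i → c i = 1 := fun i hi => by
    rcases hi.eq_or_lt with rfl | hi
    · rw [hcl _ M.lt_succ_self]
      exact he1
    · simp only [hcdef]
      rw [dif_neg (by omega)]
  refine ⟨c, ?_, hcM, fun i => ?_, fun i hi => ?_, fun i hi => ?_, fun f => ?_⟩
  · rw [hcl 0 (by omega)]
    exact he0
  · by_cases h : i + 1 < M + 1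
    · rw [hcl i (by omega), hcl (i + 1) h]
      exact e.monotone (Fin.mk_le_mk.2 (Nat.le_succ i))
    · rw [hcM (i + 1) (by omega), hcM i (by omega)]
  · rw [hcl i (by omega), hcl (M - i) (by omega), ← hrev']
    congr 1
    ext
    simp only [Fin.val_rev]
    omega
  · rw [hcl i (by omega)]
    exact hmem _
  · rw [Finset.sum_range]
    have : S = Finset.univ.map e.toEmbedding := by
      ext r
      have := Finset.range_orderEmbOfFin S hc
      rw [← Finset.mem_coe, ← this]
      simp [he]
    rw [this, Finset.sum_map]
    refine Finset.sum_congr rfl fun i _ => ?_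
    rw [hcl i i.2]
    rfl

theorem frozenTime_increments {m : ℕ} (c : ℕ → ℝ) (j : Fin m) :
    frozenTime (fun i : Fin m => c (i + 1) - c i) j = c j - c 0 := by
  rw [frozenTime_eq_sum_range, ← Finset.sum_range_sub]
  refine Finset.sum_congr rfl fun i hi => ?_
  rw [dif_pos ((Finset.mem_range.1 hi).trans j.2)]

theorem sum_increments (m : ℕ) (c : ℕ → ℝ) : ∑ i : Fin m, (c (i + 1) - c i) = c m - c 0 := by
  rw [← Finset.sum_range_sub, Finset.sum_range]

theorem exists_isClassA_quadratureOrder {q : ℕ} (hq : 1 ≤ q) : ∃ a b : Fin (q + 1) → ℝ,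
    IsClassA a b ∧ StepsNonneg a b ∧ QuadratureOrder a b (2 * q) := by
  obtain ⟨q, rfl⟩ : ∃ r, q = r + 1 := ⟨q - 1, by omega⟩
  obtain ⟨S, ω, hc, h0, hω⟩ := exists_lobatto_quadrature q
  obtain ⟨c, hc0, hc1, hmono, hrefl, hmem, hsum⟩ :=
    exists_sorted_nodes (M := q + 1) hc h0 hω.subset hω.one_sub_mem
  refine ⟨fun j => ω (c j), fun j => c (j + 1) - c j, ⟨?_, ?_, ?_⟩, ⟨?_, ?_⟩, ?_, ?_⟩
  · intro i j hij
    dsimp only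
    rw [show (j : ℕ) = q + 1 - i by omega, hrefl i (by omega), hω.weight_one_sub _ (hmem i (by omega))]
  · intro i hi
    dsimp only
    rw [hc1 i (by omega), hc1 (i + 1) (by omega), sub_self]
  · intro i j hij
    dsimp only
    rw [show (j : ℕ) + 1 = q + 1 - i by omega, hrefl i (by omega),
      show (j : ℕ) = q + 1 - (i + 1) by omega, hrefl (i + 1) (by omega)]
    ring
  · exact fun i => hω.nonneg _ (hmem i (by omega))
  · exact fun i => sub_nonneg.2 (hmono i)
  · rw [sum_increments, hc0, hc1 _ (by omega), sub_zero]
  · intro k hk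
    rw [← hω.moment k hk, ← hsum fun r => ω r * r ^ k, Finset.sum_range]
    refine Finset.sum_congr rfl fun j _ => ?_
    rw [frozenTime_increments, hc0, sub_zero]

theorem exists_isClassB_quadratureOrder (q : ℕ) : ∃ a b : Fin (q + 1) → ℝ,
    IsClassB a b ∧ StepsNonneg a b ∧ QuadratureOrder a b (2 * q) := by
  obtain ⟨s, ω, hc, hs, hω⟩ := exists_gauss_quadrature q
  have h0 : (0 : ℝ) ∉ s := fun h => lt_irrefl _ (hs h).1
  have h1 : (1 : ℝ) ∉ s := fun h => lt_irrefl _ (hs h).2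
  have h01 : (0 : ℝ) ∉ insert 1 s := by simp [h0]
  set S : Finset ℝ := insert 0 (insert 1 s) with hS
  -- The endpoints get weight zero: `0` is the idle first node of class b), and `1` is reached only
  -- after the last inner flow.
  set ω' : ℝ → ℝ := fun r => if r ∈ s then ω r else 0 with hω'
  have hmemS : ∀ {r}, r ∈ S ↔ r = 0 ∨ r = 1 ∨ r ∈ s := fun {r} => by simp [hS]
  have hsymm : ∀ r ∈ S, 1 - r ∈ S := by
    intro r hr
    rcases hmemS.1 hr with rfl | rfl | h
    · simp [hS]
    · simp [hS]
    · exact hmemS.2 (.inr (.inr (hω.one_sub_mem r h)))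
  have hω'symm : ∀ r, ω' (1 - r) = ω' r := by
    intro r
    by_cases h : r ∈ s
    · simp [hω', h, hω.one_sub_mem r h, hω.weight_one_sub r h]
    · have h' : 1 - r ∉ s := fun h2 => h (by simpa using hω.one_sub_mem _ h2)
      simp [hω', h, h']
  obtain ⟨c, hc0, hc1, hmono, hrefl, hmem, hsum⟩ := exists_sorted_nodes (S := S) (M := q + 1)
    (by rw [hS, Finset.card_insert_of_notMem h01, Finset.card_insert_of_notMem h1, hc])
    (by simp [hS]) (fun r hr => by
      rcases hmemS.1 hr with rfl | rfl | h
      · simp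
      · simp
      · exact Ioo_subset_Icc_self (hs h)) hsymm
  refine ⟨fun j => ω' (c j), fun j => c (j + 1) - c j, ⟨?_, ?_, ?_⟩, ⟨?_, ?_⟩, ?_, ?_⟩
  · intro i hi
    dsimp only
    rw [hi, hc0]
    simp [hω', h0]
  · intro i j hij
    dsimp only
    rw [show (j : ℕ) = q + 1 - i by omega, hrefl i (by omega), hω'symm]
  · intro i j hij
    dsimp only
    rw [show (j : ℕ) + 1 = q + 1 - i by omega, hrefl i (by omega),
      show (j : ℕ) = q + 1 - (i + 1) by omega, hrefl (i + 1) (by omega)]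
    ring
  · intro i
    simp only [hω']
    split_ifs with h
    · exact hω.nonneg _ h
    · exact le_rfl
  · exact fun i => sub_nonneg.2 (hmono i)
  · rw [sum_increments, hc0, hc1 _ (by omega), sub_zero]
  · intro k hk
    have e : ∑ r ∈ S, ω' r * r ^ k = ∑ r ∈ s, ω r * r ^ k := by
      rw [hS, Finset.sum_insert h01, Finset.sum_insert h1]
      simp only [hω', if_neg h0, if_neg h1, zero_mul, zero_add]
      exact Finset.sum_congr rfl fun r hr => by rw [if_pos hr]
    rw [← hω.moment k hk, ← e, ← hsum fun r => ω' r * r ^ k, Finset.sum_range_succ,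
      hc1 (q + 1) le_rfl, Finset.sum_range]
    simp only [hω', if_neg h1, zero_mul, add_zero]
    refine Finset.sum_congr rfl fun j _ => ?_
    rw [frozenTime_increments, hc0, sub_zero]

/-! ### The minimal number of degrees of freedom -/

theorem QuadratureOrder.sum_mul_eval {m : ℕ} {a b : Fin m → ℝ} {p : ℕ} (h : QuadratureOrder a b p)
    {f : ℝ[X]} (hf : f.natDegree < p) :
    ∑ j, a j * f.eval (frozenTime b j) = unitIntegral f := by
  simp only [eval_eq_sum_range' hf, Finset.mul_sum]
  rw [unitIntegral_eq_sum hf, Finset.sum_comm]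
  refine Finset.sum_congr rfl fun k hk => ?_
  rw [← h.2 k (Finset.mem_range.1 hk), Finset.mul_sum]
  exact Finset.sum_congr rfl fun j _ => by ring

theorem QuadratureOrder.le_natDegree {m : ℕ} {a b : Fin m → ℝ} {p : ℕ} (h : QuadratureOrder a b p)
    {f : ℝ[X]} (hf0 : f ≠ 0) (hf : ∀ x ∈ Icc (0 : ℝ) 1, 0 ≤ f.eval x)
    (hz : ∀ j, a j * f.eval (frozenTime b j) = 0) : p ≤ f.natDegree := by
  by_contra! hlt
  have h1 := h.sum_mul_eval hlt
  rw [Finset.sum_eq_zero fun j _ => hz j] at h1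
  exact (unitIntegral_pos hf0 hf).ne h1

/-- The annihilated polynomial has degree at most `2 (m - 1)` in both classes. In class a) the
endpoint nodes need only simple factors; in class b) node `0` needs none. Squares keep nodes outside
`[0, 1]` harmless. -/
theorem QuadratureOrder.succ_le {m : ℕ} {a b : Fin m → ℝ} (hs : IsClassA a b ∨ IsClassB a b) {q : ℕ}
    (h : QuadratureOrder a b (2 * q)) : q + 1 ≤ m := by
  obtain ⟨M, rfl⟩ : ∃ M, m = M + 1 := by
    cases m with
    | zero => exact absurd h.1 (by simp)
    | succ M => exact ⟨M, rfl⟩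
  have h0 : frozenTime b 0 = 0 := by
    rw [frozenTime_eq_sum_range]
    simp
  rcases hs with hs | hs
  · have h1 : frozenTime b (Fin.last M) = 1 := by
      rw [hs.frozenTime_reflect (i := 0) (by simp), h0, h.1, sub_zero]
    have hM : (0 : Fin (M + 1)) ≠ Fin.last M := by
      intro h2
      rw [← h2, h0] at h1
      exact zero_ne_one h1
    -- Nodes may coincide, so the cardinality is only bounded above.
    set T : Finset ℝ := ((Finset.univ.erase (0 : Fin (M + 1))).erase (Fin.last M)).image
      (frozenTime b) with hT
    have hcard : T.card ≤ M + 1 - 1 - 1 := by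
      refine Finset.card_image_le.trans (le_of_eq ?_)
      rw [Finset.card_erase_of_mem (Finset.mem_erase.2 ⟨hM.symm, Finset.mem_univ _⟩),
        Finset.card_erase_of_mem (Finset.mem_univ _), Finset.card_univ, Fintype.card_fin]
    have hl : (1 - X : ℝ[X]) = -(X - C 1) := by simp
    have hd : (1 - X : ℝ[X]).natDegree = 1 := by rw [hl, natDegree_neg, natDegree_X_sub_C]
    have hne : (1 - X : ℝ[X]) ≠ 0 := by
      rw [hl]
      exact neg_ne_zero.2 (X_sub_C_ne_zero 1)
    have key := h.le_natDegree (f := X * (1 - X) * nodePoly T ^ 2)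
      (mul_ne_zero (mul_ne_zero X_ne_zero hne) (pow_ne_zero 2 (nodePoly_monic T).ne_zero))
      (fun x hx => by
        rw [eval_mul, eval_pow]
        refine mul_nonneg ?_ (sq_nonneg _)
        simpa using mul_nonneg hx.1 (sub_nonneg.2 hx.2))
      (fun j => by
        by_cases hj0 : j = 0
        · simp [hj0, h0]
        by_cases hj1 : j = Fin.last M
        · simp [hj1, h1]
        have hj : frozenTime b j ∈ T := Finset.mem_image_of_mem _
          (Finset.mem_erase.2 ⟨hj1, Finset.mem_erase.2 ⟨hj0, Finset.mem_univ _⟩⟩)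
        rw [eval_mul, eval_pow, eval_nodePoly_eq_zero_iff.2 hj]
        ring)
    have h2 : (X * (1 - X) : ℝ[X]).natDegree ≤ 1 + 1 :=
      natDegree_mul_le.trans (by rw [hd, natDegree_X])
    have h3 := key.trans natDegree_mul_le
    rw [natDegree_pow, natDegree_nodePoly] at h3
    have hM0 : M ≠ 0 := by
      rintro rfl
      exact hM rfl
    omega
  · set T : Finset ℝ := (Finset.univ.erase (0 : Fin (M + 1))).image (frozenTime b) with hT
    have hcard : T.card ≤ M + 1 - 1 := by
      refine Finset.card_image_le.trans (le_of_eq ?_)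
      rw [Finset.card_erase_of_mem (Finset.mem_univ _), Finset.card_univ, Fintype.card_fin]
    have key := h.le_natDegree (f := nodePoly T ^ 2) (pow_ne_zero 2 (nodePoly_monic T).ne_zero)
      (fun x _ => by
        rw [eval_pow]
        exact sq_nonneg _)
      (fun j => by
        by_cases hj0 : j = 0
        · rw [hj0, hs.1 0 rfl, zero_mul]
        have hj : frozenTime b j ∈ T := Finset.mem_image_of_mem _
          (Finset.mem_erase.2 ⟨hj0, Finset.mem_univ _⟩)
        rw [eval_pow, eval_nodePoly_eq_zero_iff.2 hj]
        ring)
    rw [natDegree_pow, natDegree_nodePoly] at key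
    omega

end Schemes

/-! ### The methods of order four and six -/

theorem frozenTime_fin_three (b : Fin 3 → ℝ) :
    frozenTime b 0 = 0 ∧ frozenTime b 1 = b 0 ∧ frozenTime b 2 = b 0 + b 1 := by
  simp [frozenTime_eq_sum_ite, Fin.sum_univ_three]

theorem frozenTime_fin_four (b : Fin 4 → ℝ) :
    frozenTime b 0 = 0 ∧ frozenTime b 1 = b 0 ∧ frozenTime b 2 = b 0 + b 1 ∧
      frozenTime b 3 = b 0 + b 1 + b 2 := by
  simp [frozenTime_eq_sum_ite, Fin.sum_univ_four]

theorem quadratureOrder_fin_three_iff {a b : Fin 3 → ℝ} {p : ℕ} : QuadratureOrder a b p ↔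
    b 0 + b 1 + b 2 = 1 ∧ ∀ k < p,
      a 0 * 0 ^ k + a 1 * b 0 ^ k + a 2 * (b 0 + b 1) ^ k = 1 / ((k : ℝ) + 1) := by
  obtain ⟨h0, h1, h2⟩ := frozenTime_fin_three b
  simp only [QuadratureOrder, Fin.sum_univ_three, h0, h1, h2]

theorem quadratureOrder_fin_four_iff {a b : Fin 4 → ℝ} {p : ℕ} : QuadratureOrder a b p ↔
    b 0 + b 1 + b 2 + b 3 = 1 ∧ ∀ k < p,
      a 0 * 0 ^ k + a 1 * b 0 ^ k + a 2 * (b 0 + b 1) ^ k + a 3 * (b 0 + b 1 + b 2) ^ k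
        = 1 / ((k : ℝ) + 1) := by
  obtain ⟨h0, h1, h2, h3⟩ := frozenTime_fin_four b
  simp only [QuadratureOrder, Fin.sum_univ_four, h0, h1, h2, h3]

/-- The moments determine `b_1` only up to reflection at `1 / 2`; nonnegativity of the other `b`
selects the root. -/
theorem eq_of_mul_one_sub_eq {x y : ℝ} (h : x * (1 - x) = y * (1 - y)) (hx : x ≤ 1 / 2)
    (hy : y < 1 / 2) : x = y := by
  have h1 : (x - y) * (1 - x - y) = 0 := by linarith
  rcases mul_eq_zero.1 h1 with h2 | h2 <;> linarith

theorem isClassA_order_four : IsClassA ![1 / 6, 2 / 3, 1 / 6] (![1 / 2, 1 / 2, 0] : Fin 3 → ℝ) ∧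
    StepsNonneg ![1 / 6, 2 / 3, 1 / 6] (![1 / 2, 1 / 2, 0] : Fin 3 → ℝ) ∧
    QuadratureOrder ![1 / 6, 2 / 3, 1 / 6] (![1 / 2, 1 / 2, 0] : Fin 3 → ℝ) 4 := by
  refine ⟨?_, ?_, ?_⟩
  · simp [IsClassA, Fin.forall_fin_succ]
  · constructor <;> intro i <;> fin_cases i <;> norm_num
  · rw [quadratureOrder_fin_three_iff]
    simp only [cons_val_zero, cons_val_one, cons_val]
    refine ⟨by norm_num, fun k hk => ?_⟩
    interval_cases k <;> norm_num

theorem eq_of_isClassA_order_four {a b : Fin 3 → ℝ} (hc : IsClassA a b)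
    (h : QuadratureOrder a b 4) : a = ![1 / 6, 2 / 3, 1 / 6] ∧ b = ![1 / 2, 1 / 2, 0] := by
  obtain ⟨hb, hm⟩ := quadratureOrder_fin_three_iff.1 h
  have ha2 : a 0 = a 2 := hc.1 0 2 rfl
  have hb2 : b 2 = 0 := hc.2.1 2 rfl
  have hb1 : b 0 = b 1 := hc.2.2 0 1 rfl
  have hb0 : b 0 = 1 / 2 := by linarith
  -- For symmetric formulas the even moments imply the odd ones, so they suffice for uniqueness.
  have h0 := hm 0 (by norm_num)
  have h2 := hm 2 (by norm_num)
  rw [← hb1, hb0] at h0 h2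
  norm_num at h0 h2
  constructor
  · ext i
    fin_cases i <;> simp <;> linarith
  · ext i
    fin_cases i <;> simp <;> linarith

theorem isClassB_order_four :
    IsClassB ![0, 1 / 2, 1 / 2] ![(3 - √3) / 6, √3 / 3, (3 - √3) / 6] ∧
    StepsNonneg ![0, 1 / 2, 1 / 2] ![(3 - √3) / 6, √3 / 3, (3 - √3) / 6] ∧
    QuadratureOrder ![0, 1 / 2, 1 / 2] ![(3 - √3) / 6, √3 / 3, (3 - √3) / 6] 4 := by
  have h3 : √3 ^ 2 = 3 := Real.sq_sqrt (by norm_num)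
  have hle : √3 ≤ 3 := Real.sqrt_le_iff.2 (by norm_num)
  have hpos : 0 ≤ √3 := Real.sqrt_nonneg 3
  refine ⟨?_, ?_, ?_⟩
  · simp [IsClassB, Fin.forall_fin_succ]
  · constructor <;> intro i <;> fin_cases i <;> norm_num <;> linarith
  · rw [quadratureOrder_fin_three_iff]
    simp only [cons_val_zero, cons_val_one, cons_val]
    generalize √3 = s at h3
    refine ⟨by ring, fun k hk => ?_⟩
    interval_cases k <;> norm_num
    · ring
    · linear_combination (1 / 36) * h3
    · linear_combination (1 / 24) * h3

theorem eq_of_isClassB_order_four {a b : Fin 3 → ℝ} (hc : IsClassB a b) (hn : StepsNonneg a b)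
    (h : QuadratureOrder a b 4) :
    a = ![0, 1 / 2, 1 / 2] ∧ b = ![(3 - √3) / 6, √3 / 3, (3 - √3) / 6] := by
  have h3 : √3 ^ 2 = 3 := Real.sq_sqrt (by norm_num)
  have hpos : 0 < √3 := Real.sqrt_pos.2 (by norm_num)
  obtain ⟨hb, hm⟩ := quadratureOrder_fin_three_iff.1 h
  have ha0 : a 0 = 0 := hc.1 0 rfl
  have ha2 : a 1 = a 2 := hc.2.1 1 2 rfl
  have hb2 : b 0 = b 2 := hc.2.2 0 2 rfl
  have hb1 := hn.2 1
  have h0 := hm 0 (by norm_num)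
  have h2 := hm 2 (by norm_num)
  have ha1 : a 1 = 1 / 2 := by
    norm_num at h0
    linarith
  rw [← ha2, ha1, ha0, show b 0 + b 1 = 1 - b 0 by linarith] at h2
  norm_num at h2
  have hb0 : b 0 = (3 - √3) / 6 := by
    refine eq_of_mul_one_sub_eq ?_ (by linarith) (by linarith)
    linear_combination -h2 + (1 / 36) * h3
  constructor
  · ext i
    fin_cases i <;> simp <;> linarith
  · ext i
    fin_cases i <;> simp <;> linarith

theorem isClassA_order_six :
    IsClassA ![1 / 12, 5 / 12, 5 / 12, 1 / 12] ![(5 - √5) / 10, √5 / 5, (5 - √5) / 10, 0] ∧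
    StepsNonneg ![1 / 12, 5 / 12, 5 / 12, 1 / 12] ![(5 - √5) / 10, √5 / 5, (5 - √5) / 10, 0] ∧
    QuadratureOrder ![1 / 12, 5 / 12, 5 / 12, 1 / 12]
      ![(5 - √5) / 10, √5 / 5, (5 - √5) / 10, 0] 6 := by
  have h5 : √5 ^ 2 = 5 := Real.sq_sqrt (by norm_num)
  have hle : √5 ≤ 5 := Real.sqrt_le_iff.2 (by norm_num)
  have hpos : 0 ≤ √5 := Real.sqrt_nonneg 5
  refine ⟨?_, ?_, ?_⟩
  · simp [IsClassA, Fin.forall_fin_succ]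
  · constructor <;> intro i <;> fin_cases i <;> norm_num <;> linarith
  · rw [quadratureOrder_fin_four_iff]
    simp only [cons_val_zero, cons_val_one, cons_val]
    generalize √5 = s at h5
    refine ⟨by ring, fun k hk => ?_⟩
    interval_cases k <;> norm_num
    · ring
    · linear_combination (1 / 120) * h5
    · linear_combination (1 / 80) * h5
    -- Fourth powers enter through `s ^ 4 - 25 = (s ^ 2 + 5) * (s ^ 2 - 5)`.
    · linear_combination (1 / 80 + (s ^ 2 + 5) / 12000) * h5
    · linear_combination (1 / 96 + (s ^ 2 + 5) / 4800) * h5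

theorem eq_of_isClassA_order_six {a b : Fin 4 → ℝ} (hc : IsClassA a b) (hn : StepsNonneg a b)
    (h : QuadratureOrder a b 6) : a = ![1 / 12, 5 / 12, 5 / 12, 1 / 12] ∧
      b = ![(5 - √5) / 10, √5 / 5, (5 - √5) / 10, 0] := by
  have h5 : √5 ^ 2 = 5 := Real.sq_sqrt (by norm_num)
  have hpos : 0 < √5 := Real.sqrt_pos.2 (by norm_num)
  obtain ⟨hb, hm⟩ := quadratureOrder_fin_four_iff.1 h
  have ha3 : a 0 = a 3 := hc.1 0 3 rfl
  have ha2 : a 1 = a 2 := hc.1 1 2 rfl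
  have hb3 : b 3 = 0 := hc.2.1 3 rfl
  have hb2 : b 0 = b 2 := hc.2.2 0 2 rfl
  have hb1 := hn.2 1
  have h0 := hm 0 (by norm_num)
  have h2 := hm 2 (by norm_num)
  have h4 := hm 4 (by norm_num)
  rw [← ha2, ← ha3, show b 0 + b 1 + b 2 = 1 by linarith, show b 0 + b 1 = 1 - b 0 by linarith]
    at h0 h2 h4
  norm_num at h0 h2 h4
  have ha0 : a 0 = 1 / 2 - a 1 := by linarith
  rw [ha0] at h2 h4
  -- With `u = x (1 - x)` one has `x² + (1 - x)² = 1 - 2u` and `x⁴ + (1 - x)⁴ = 1 - 4u + 2u²`, so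
  -- the fourth moment becomes linear in `u` once `a 1 * u` is known.
  have hu : a 1 * (b 0 * (1 - b 0)) = 1 / 12 := by linear_combination (-1 / 2) * h2
  have hu2 : b 0 * (1 - b 0) = 1 / 5 := by
    linear_combination 6 * h4 + (24 - 12 * (b 0 * (1 - b 0))) * hu
  have ha1 : a 1 = 5 / 12 := by
    rw [hu2] at hu
    linarith
  have hb0 : b 0 = (5 - √5) / 10 := by
    refine eq_of_mul_one_sub_eq ?_ (by linarith) (by linarith)
    linear_combination hu2 + (1 / 100) * h5
  constructor
  · ext i
    fin_cases i <;> simp <;> linarith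
  · ext i
    fin_cases i <;> simp <;> linarith

theorem isClassB_order_six :
    IsClassB ![0, 5 / 18, 4 / 9, 5 / 18]
      ![(5 - √15) / 10, √15 / 10, √15 / 10, (5 - √15) / 10] ∧
    StepsNonneg ![0, 5 / 18, 4 / 9, 5 / 18]
      ![(5 - √15) / 10, √15 / 10, √15 / 10, (5 - √15) / 10] ∧
    QuadratureOrder ![0, 5 / 18, 4 / 9, 5 / 18]
      ![(5 - √15) / 10, √15 / 10, √15 / 10, (5 - √15) / 10] 6 := by
  have h15 : √15 ^ 2 = 15 := Real.sq_sqrt (by norm_num)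
  have hle : √15 ≤ 5 := Real.sqrt_le_iff.2 (by norm_num)
  have hpos : 0 ≤ √15 := Real.sqrt_nonneg 15
  refine ⟨?_, ?_, ?_⟩
  · simp [IsClassB, Fin.forall_fin_succ]
  · constructor <;> intro i <;> fin_cases i <;> norm_num <;> linarith
  · rw [quadratureOrder_fin_four_iff]
    simp only [cons_val_zero, cons_val_one, cons_val]
    generalize √15 = s at h15
    refine ⟨by ring, fun k hk => ?_⟩
    interval_cases k <;> norm_num
    · ring
    · linear_combination (1 / 180) * h15
    · linear_combination (1 / 120) * h15
    · linear_combination (1 / 120 + (s ^ 2 + 15) / 18000) * h15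
    · linear_combination (1 / 144 + (s ^ 2 + 15) / 7200) * h15

theorem eq_of_isClassB_order_six {a b : Fin 4 → ℝ} (hc : IsClassB a b) (hn : StepsNonneg a b)
    (h : QuadratureOrder a b 6) : a = ![0, 5 / 18, 4 / 9, 5 / 18] ∧
      b = ![(5 - √15) / 10, √15 / 10, √15 / 10, (5 - √15) / 10] := by
  have h15 : √15 ^ 2 = 15 := Real.sq_sqrt (by norm_num)
  have hpos : 0 < √15 := Real.sqrt_pos.2 (by norm_num)
  obtain ⟨hb, hm⟩ := quadratureOrder_fin_four_iff.1 h
  have ha0 : a 0 = 0 := hc.1 0 rfl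
  have ha3 : a 1 = a 3 := hc.2.1 1 3 rfl
  have hb3 : b 0 = b 3 := hc.2.2 0 3 rfl
  have hb2 : b 1 = b 2 := hc.2.2 1 2 rfl
  have hb1 := hn.2 1
  have h0 := hm 0 (by norm_num)
  have h2 := hm 2 (by norm_num)
  have h4 := hm 4 (by norm_num)
  rw [← ha3, ha0, show b 0 + b 1 + b 2 = 1 - b 0 by linarith, show b 0 + b 1 = 1 / 2 by linarith]
    at h0 h2 h4
  norm_num at h0 h2 h4
  have ha2 : a 2 = 1 - 2 * a 1 := by linarith
  rw [ha2] at h2 h4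
  -- Here `1 / 4 - x (1 - x) = (1 / 2 - x)²` is the squared distance of the outer nodes from the
  -- midpoint node.
  have hv : a 1 * (1 / 4 - b 0 * (1 - b 0)) = 1 / 24 := by linear_combination (1 / 2) * h2
  have hv2 : b 0 * (1 - b 0) = 1 / 10 := by
    linear_combination -12 * h4 + (36 + 24 * (1 / 4 - b 0 * (1 - b 0))) * hv
  have ha1 : a 1 = 5 / 18 := by
    rw [hv2] at hv
    linarith
  have hb0 : b 0 = (5 - √15) / 10 := by
    refine eq_of_mul_one_sub_eq ?_ (by linarith) (by linarith)
    linear_combination hv2 + (1 / 100) * h15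
  constructor
  · ext i
    fin_cases i <;> simp <;> linarith
  · ext i
    fin_cases i <;> simp <;> linarith

end PortSplitting

theorem mainTheorem4 :
    -- Order conditions: a symmetric scheme has order `2 q` if and only if `q + 1` equations hold.
    (∀ (m : ℕ) (a b : Fin m → ℝ), (IsClassA a b ∨ IsClassB a b) →
      ∀ q : ℕ, 1 ≤ q → ∀ n : ℕ, 1 ≤ n →
        (HasOrder n a b (2 * q) ↔
          eOne a b = 1 ∧ eTwo a b = 1 ∧
            ∀ i : ℕ, 1 ≤ i → i < q → eNested a b (2 * i + 1) = 0)) ∧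
    -- Order 4, class a): the 5-stage method.
    (∀ a b : Fin 3 → ℝ, a = ![1 / 6, 2 / 3, 1 / 6] → b = ![1 / 2, 1 / 2, 0] →
      IsClassA a b ∧ StepsNonneg a b ∧ (∀ n : ℕ, HasOrder n a b 4) ∧
        ∀ a' b' : Fin 3 → ℝ, IsClassA a' b' → StepsNonneg a' b' →
          ∀ n : ℕ, 1 ≤ n → HasOrder n a' b' 4 → a' = a ∧ b' = b) ∧
    -- Order 4, class b): the 5-stage method.
    (∀ a b : Fin 3 → ℝ, a = ![0, 1 / 2, 1 / 2] →
      b = ![(3 - √3) / 6, √3 / 3, (3 - √3) / 6] →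
      IsClassB a b ∧ StepsNonneg a b ∧ (∀ n : ℕ, HasOrder n a b 4) ∧
        ∀ a' b' : Fin 3 → ℝ, IsClassB a' b' → StepsNonneg a' b' →
          ∀ n : ℕ, 1 ≤ n → HasOrder n a' b' 4 → a' = a ∧ b' = b) ∧
    -- Order 6, class a): the 7-stage method.
    (∀ a b : Fin 4 → ℝ, a = ![1 / 12, 5 / 12, 5 / 12, 1 / 12] →
      b = ![(5 - √5) / 10, √5 / 5, (5 - √5) / 10, 0] →
      IsClassA a b ∧ StepsNonneg a b ∧ (∀ n : ℕ, HasOrder n a b 6) ∧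
        ∀ a' b' : Fin 4 → ℝ, IsClassA a' b' → StepsNonneg a' b' →
          ∀ n : ℕ, 1 ≤ n → HasOrder n a' b' 6 → a' = a ∧ b' = b) ∧
    -- Order 6, class b): the 7-stage method.
    (∀ a b : Fin 4 → ℝ, a = ![0, 5 / 18, 4 / 9, 5 / 18] →
      b = ![(5 - √15) / 10, √15 / 10, √15 / 10, (5 - √15) / 10] →
      IsClassB a b ∧ StepsNonneg a b ∧ (∀ n : ℕ, HasOrder n a b 6) ∧
        ∀ a' b' : Fin 4 → ℝ, IsClassB a' b' → StepsNonneg a' b' →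
          ∀ n : ℕ, 1 ≤ n → HasOrder n a' b' 6 → a' = a ∧ b' = b) ∧
    -- Every even order `p = 2 q`: `m = q + 1` degrees of freedom suffice, in both classes and with
    -- nonnegative step sizes, and no symmetric scheme has this order with fewer.
    (∀ q : ℕ, 1 ≤ q →
      (∃ a b : Fin (q + 1) → ℝ, IsClassA a b ∧ StepsNonneg a b ∧
        ∀ n : ℕ, HasOrder n a b (2 * q)) ∧
      (∃ a b : Fin (q + 1) → ℝ, IsClassB a b ∧ StepsNonneg a b ∧
        ∀ n : ℕ, HasOrder n a b (2 * q)) ∧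
      ∀ (m : ℕ) (a b : Fin m → ℝ), (IsClassA a b ∨ IsClassB a b) →
        ∀ n : ℕ, 1 ≤ n → HasOrder n a b (2 * q) → q + 1 ≤ m) := by 
  refine ⟨fun m a b hs q hq n hn => ?_, ?_, ?_, ?_, ?_, fun q hq => ⟨?_, ?_, ?_⟩⟩
  · rw [hasOrder_iff_quadratureOrder hn (by omega), quadratureOrder_iff_eNested hs hq]
  · rintro a b rfl rfl
    obtain ⟨h1, h2, h3⟩ := isClassA_order_four
    exact ⟨h1, h2, h3.hasOrder, fun a' b' hc _ n hn ho => eq_of_isClassA_order_four hc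
      ((hasOrder_iff_quadratureOrder hn (by norm_num)).1 ho)⟩
  · rintro a b rfl rfl
    obtain ⟨h1, h2, h3⟩ := isClassB_order_four
    exact ⟨h1, h2, h3.hasOrder, fun a' b' hc hnn n hn ho => eq_of_isClassB_order_four hc hnn
      ((hasOrder_iff_quadratureOrder hn (by norm_num)).1 ho)⟩
  · rintro a b rfl rfl
    obtain ⟨h1, h2, h3⟩ := isClassA_order_six
    exact ⟨h1, h2, h3.hasOrder, fun a' b' hc hnn n hn ho => eq_of_isClassA_order_six hc hnn
      ((hasOrder_iff_quadratureOrder hn (by norm_num)).1 ho)⟩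
  · rintro a b rfl rfl
    obtain ⟨h1, h2, h3⟩ := isClassB_order_six
    exact ⟨h1, h2, h3.hasOrder, fun a' b' hc hnn n hn ho => eq_of_isClassB_order_six hc hnn
      ((hasOrder_iff_quadratureOrder hn (by norm_num)).1 ho)⟩
  · obtain ⟨a, b, h1, h2, h3⟩ := exists_isClassA_quadratureOrder hq
    exact ⟨a, b, h1, h2, h3.hasOrder⟩
  · obtain ⟨a, b, h1, h2, h3⟩ := exists_isClassB_quadratureOrder q
    exact ⟨a, b, h1, h2, h3.hasOrder⟩
  · exact fun m a b hs n hn ho =>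
      ((hasOrder_iff_quadratureOrder hn (by omega)).1 ho).succ_le hs
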